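/- Let $C$ be a smooth projective irreducible curve over $\mathbb{C}$ with generic point $\eta$, let $L$ be a line bundle on $C$, and let $W$ be a vector bundle of rank $2n$ on $C$ with an $L$-valued symplectic form $\omega$, that is, a skew-symmetric bilinear form $\omega\colon W\otimes W\to L$ inducing an isomorphism $W\cong \mathcal{H}om(W,L)$. Let $F\subset W$ be a Lagrangian subbundle, i.e. a subbundle of rank $n$ with $\omega|_{F\otimes F}=0$. For a vector bundle $V$ write $\underline{\mathrm{Rat}}(V)$ for the sheaf of rational sections of $V$ (the constant sheaf $V_\eta$), $\underline{\mathrm{Prin}}(V)=\underline{\mathrm{Rat}}(V)/V$ for the sheaf of principal parts, $\mathrm{Prin}(V)=H^0(C,\underline{\mathrm{Prin}}(V))$, $\overline f$ for the class of $f\in\underline{\mathrm{Rat}}(V)$ in $\underline{\mathrm{Prin}}(V)$, and $[p]\in H^1(C,V)$ for the image of $p\in\mathrm{Prin}(V)$ under the connecting map of $0\to V\to\underline{\mathrm{Rat}}(V)\to\underline{\mathrm{Prin}}(V)\to 0$. Identify $F^*\otimes L$ with $\mathcal{H}om(F,L)$, $L^{-1}\otimes F\otimes F$ with $\mathcal{H}om(F^*\otimes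 L,F)$, and $L^{-1}\otimes\mathrm{Sym}^2F$ with the subsheaf of those homomorphisms $\varphi\colon F^*\otimes L\to F$ with $\langle \varphi(a),b\rangle=\langle\varphi(b),a\rangle$ in $L$ for all local sections $a,b$ of $F^*\otimes L$. A symmetric principal part $p\in \mathrm{Prin}(L^{-1}\otimes\mathrm{Sym}^2F)$ induces a map $p\colon F^*\otimes L\to\underline{\mathrm{Prin}}(F)$, and we put $$W_p=\{(f,\varphi)\in\underline{\mathrm{Rat}}(F)\oplus(F^*\otimes L) : \overline f=p(\varphi)\}.$$ (a) There is a symmetric principal part $p\in\mathrm{Prin}(L^{-1}\otimes\mathrm{Sym}^2F)$ such that the standard form $$\omega_p\big((f_1,\varphi_1),(f_2,\varphi_2)\big)=\langle f_2,\varphi_1\rangle-\langle f_1,\varphi_2\rangle$$ is a regular $L$-valued symplectic form on $W_p$, together with an isomorphism of vector bundles $\iota\colon W\to W_p$ with $\iota^*\omega_p=\omega$ and $\iota(f)=(f,0)$ for every local section $f$ of $F$. In particular $\iota(F)=\{(f,0):f\in F\}=W_p\cap\underline{\mathrm{Rat}}(F)$. (b) For every symmetric principal part $p\in\mathrm{Prin}(L^{-1}\otimes\mathrm{Sym}^2F)$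 the sequence $0\to F\to W_p\to F^*\otimes L\to 0$ given by $f\mapsto(f,0)$ and $(f,\varphi)\mapsto\varphi$ is exact, and the class of this extension (the image of $\mathrm{id}$ under the connecting map $H^0(C,\mathcal{E}nd(F^*\otimes L))\to H^1(C,\mathcal{H}om(F^*\otimes L,F))=H^1(C,L^{-1}\otimes F\otimes F)$ obtained by applying $\mathcal{H}om(F^*\otimes L,-)$) is the image of $[p]\in H^1(C,L^{-1}\otimes\mathrm{Sym}^2F)$, and of no other class in $H^1(C,L^{-1}\otimes\mathrm{Sym}^2F)$. -/

import Mathlib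

open CategoryTheory TopologicalSpace Opposite AlgebraicGeometry

namespace SympExt

universe u

/-- Explicit data of a sheaf of abelian groups: sections, restrictions, and the two sheaf axioms. -/
structure AbData (X : TopCat.{u}) where
  sec : Opens X → Type u
  [grp : ∀ U, AddCommGroup (sec U)]
  res : ∀ {U V : Opens X}, V ≤ U → sec U →+ sec V
  res_id : ∀ {U : Opens X} (s : sec U), res le_rfl s = s
  res_res : ∀ {U V W : Opens X} (h : V ≤ U) (k : W ≤ V) (s : sec U),
    res k (res h s) = res (k.trans h) s
  sep : ∀ {ι : Type u} (U : ι → Opens X) (s t : sec (iSup U)),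
    (∀ i, res (le_iSup U i) s = res (le_iSup U i) t) → s = t
  glue : ∀ {ι : Type u} (U : ι → Opens X) (s : ∀ i, sec (U i)),
    (∀ i j, res (inf_le_left : U i ⊓ U j ≤ U i) (s i)
      = res (inf_le_right : U i ⊓ U j ≤ U j) (s j)) →
    ∃ t : sec (iSup U), ∀ i, res (le_iSup U i) t = s i

attribute [instance] AbData.grp

namespace AbData

variable {X : TopCat.{u}} (D : AbData X)

/-- The presheaf with the given sections. -/
def presheaf : TopCat.Presheaf Ab.{u} X where
  obj U := AddCommGrpCat.of (D.sec U.unop)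
  map f := AddCommGrpCat.ofHom (D.res f.unop.le)
  map_id U := by ext s; exact D.res_id s
  map_comp f g := by ext s; exact (D.res_res f.unop.le g.unop.le s).symm

lemma isSheaf : D.presheaf.IsSheaf := by
  rw [TopCat.Presheaf.isSheaf_iff_isSheafUniqueGluing]
  intro ι U s hs
  obtain ⟨t, ht⟩ := D.glue U s hs
  exact ⟨t, ht, fun t' ht' => D.sep U t' t fun i => (ht' i).trans (ht i).symm⟩

/-- The sheaf with the given sections. -/
def sheaf : TopCat.Sheaf Ab.{u} X := ⟨D.presheaf, D.isSheaf⟩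

end AbData

/-- Explicit data of a sheaf of `𝒪`-modules. -/
structure ModData (C : Scheme.{u}) extends AbData C.toTopCat where
  [mod : ∀ U : C.Opens, Module Γ(C, U) (sec U)]
  res_smul : ∀ {U V : C.Opens} (h : V ≤ U) (r : Γ(C, U)) (s : sec U),
    res h (r • s) = (C.presheaf.map (homOfLE h).op r : Γ(C, V)) • res h s

attribute [instance] ModData.mod

namespace ModData
variable {C : Scheme.{u}} (D : ModData C)

/-- The sheaf of `𝒪`-modules with the given sections. -/
noncomputable def toModules : C.Modules :=
  letI (U : C.Opensᵒᵖ) : Module (C.ringCatSheaf.obj.obj U) (D.toAbData.presheaf.obj U) :=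
    inferInstanceAs (Module Γ(C, U.unop) (D.sec U.unop))
  { val := PresheafOfModules.ofPresheaf (R := C.ringCatSheaf.obj) D.toAbData.presheaf
      (fun _ _ f r m => D.res_smul f.unop.le r m)
    isSheaf := D.toAbData.isSheaf }

end ModData


section Sections

variable {C : Scheme.{u}} (M : C.Modules)

/-- Restriction of sections. -/
noncomputable def res {U V : C.Opens} (h : V ≤ U) : Γ(M, U) →+ Γ(M, V) :=
  (M.presheaf.map (homOfLE h).op).hom

/-- Restriction of regular functions. -/
noncomputable def fres {U V : C.Opens} (h : V ≤ U) : Γ(C, U) →+* Γ(C, V) :=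
  (C.presheaf.map (homOfLE h).op).hom

lemma fres_id {U : C.Opens} (r : Γ(C, U)) : fres (le_rfl : U ≤ U) r = r := by
  change (C.presheaf.map (𝟙 _)) r = r
  simp

lemma fres_fres {U V W : C.Opens} (h : V ≤ U) (k : W ≤ V) (r : Γ(C, U)) :
    fres k (fres h r) = fres (k.trans h) r := by
  change (C.presheaf.map (homOfLE h).op ≫ C.presheaf.map (homOfLE k).op) r = _
  rw [← Functor.map_comp]
  rfl

lemma res_id {U : C.Opens} (s : Γ(M, U)) : res M (le_rfl : U ≤ U) s = s := by
  change (M.presheaf.map (𝟙 _)) s = s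
  simp

lemma res_res {U V W : C.Opens} (h : V ≤ U) (k : W ≤ V) (s : Γ(M, U)) :
    res M k (res M h s) = res M (k.trans h) s := by
  change (M.presheaf.map (homOfLE h).op ≫ M.presheaf.map (homOfLE k).op) s = _
  rw [← Functor.map_comp]
  rfl

lemma res_smul {U V : C.Opens} (h : V ≤ U) (r : Γ(C, U)) (s : Γ(M, U)) :
    res M h (r • s) = fres h r • res M h s :=
  Scheme.Modules.map_smul M (homOfLE h) r s

lemma germ_res {U V : C.Opens} (h : V ≤ U) (x : C) (hx : x ∈ V) (s : Γ(M, U)) :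
    M.presheaf.germ V x hx (res M h s) = M.presheaf.germ U x (h hx) s :=
  TopCat.Presheaf.germ_res_apply M.presheaf (homOfLE h) x hx s

lemma germ_fres {U V : C.Opens} (h : V ≤ U) (x : C) (hx : x ∈ V) (s : Γ(C, U)) :
    C.presheaf.germ V x hx (fres h s) = C.presheaf.germ U x (h hx) s :=
  TopCat.Presheaf.germ_res_apply C.presheaf (homOfLE h) x hx s

/-- Sections which agree on an open cover agree. -/
lemma sep {ι : Type u} {V : C.Opens} (U : ι → C.Opens) (hU : ∀ i, U i ≤ V) (hV : V ≤ iSup U)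
    (s t : Γ(M, V)) (h : ∀ i, res M (hU i) s = res M (hU i) t) : s = t :=
  TopCat.Sheaf.eq_of_locally_eq' (⟨M.presheaf, M.isSheaf⟩ : TopCat.Sheaf Ab.{u} C.toTopCat) U V
    (fun i => homOfLE (hU i)) hV s t h

/-- Compatible sections on an open cover glue. -/
lemma glue {ι : Type u} {V : C.Opens} (U : ι → C.Opens) (hU : ∀ i, U i ≤ V) (hV : V ≤ iSup U)
    (s : ∀ i, Γ(M, U i))
    (h : ∀ i j, res M (inf_le_left : U i ⊓ U j ≤ U i) (s i)
      = res M (inf_le_right : U i ⊓ U j ≤ U j) (s j)) :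
    ∃ t : Γ(M, V), ∀ i, res M (hU i) t = s i :=
  (TopCat.Sheaf.existsUnique_gluing' (⟨M.presheaf, M.isSheaf⟩ : TopCat.Sheaf Ab.{u} C.toTopCat) U V
    (fun i => homOfLE (hU i)) hV s h).exists

/-- The `𝒪_x`-module structure on the stalk `M_x`. -/
noncomputable instance stalkModule (x : C) :
    Module (C.presheaf.stalk x) (M.presheaf.stalk x) :=
  PresheafOfModules.instModuleCarrierStalkCommRingCatCarrierAbPresheafOpensCarrier
    (R := C.presheaf) M.val x

lemma germ_smul {U : C.Opens} (x : C) (hx : x ∈ U) (r : Γ(C, U)) (m : Γ(M, U)) :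
    M.presheaf.germ U x hx (r • m) = C.presheaf.germ U x hx r • M.presheaf.germ U x hx m :=
  PresheafOfModules.germ_smul (R := C.presheaf) M.val x U hx r m

variable {M}

/-- A morphism of `𝒪`-modules from a compatible family of linear maps. -/
noncomputable def homMk {N : C.Modules} (φ : ∀ U : C.Opens, Γ(M, U) →ₗ[Γ(C, U)] Γ(N, U))
    (hφ : ∀ {U V : C.Opens} (h : V ≤ U) (s : Γ(M, U)), φ V (res M h s) = res N h (φ U s)) :
    M ⟶ N where
  val := PresheafOfModules.homMk (M₁ := M.val) (M₂ := N.val)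
    { app := fun U => AddCommGrpCat.ofHom (φ U.unop).toAddMonoidHom
      naturality := fun U V f => by ext s; exact hφ f.unop.le s }
    (fun U r m => (φ U.unop).map_smul r m)

lemma homMk_app {N : C.Modules} (φ : ∀ U : C.Opens, Γ(M, U) →ₗ[Γ(C, U)] Γ(N, U))
    (hφ : ∀ {U V : C.Opens} (h : V ≤ U) (s : Γ(M, U)), φ V (res M h s) = res N h (φ U s))
    (U : C.Opens) (s : Γ(M, U)) : (homMk φ hφ).app U s = φ U s := rfl

lemma app_res {N : C.Modules} (f : M ⟶ N) {U V : C.Opens} (h : V ≤ U) (s : Γ(M, U)) :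
    f.app V (res M h s) = res N h (f.app U s) :=
  congr($(f.mapPresheaf.naturality (homOfLE h).op) s)

/-- The map on sections over `U` as a linear map. -/
noncomputable def appLin {N : C.Modules} (f : M ⟶ N) (U : C.Opens) :
    Γ(M, U) →ₗ[Γ(C, U)] Γ(N, U) where
  toFun := f.app U
  map_add' := map_add _
  map_smul' r s := Scheme.Modules.Hom.app_smul f r s

end Sections

section SheafHom

variable {C : Scheme.{u}} (M N : C.Modules)

/-- The group of morphisms of sheaves of `𝒪_U`-modules `M|_U ⟶ N|_U`: families of
`𝒪(V)`-linear maps `M(V) → N(V)`, for `V ⊆ U`, compatible with restrictions. -/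
noncomputable def homSec (U : C.Opens) :
    AddSubgroup (∀ V : {V : C.Opens // V ≤ U}, Γ(M, V.1) →ₗ[Γ(C, V.1)] Γ(N, V.1)) where
  carrier := {φ | ∀ (V W : {V : C.Opens // V ≤ U}) (h : W.1 ≤ V.1) (m : Γ(M, V.1)),
    res N h (φ V m) = φ W (res M h m)}
  zero_mem' V W h m := by simp
  add_mem' {φ ψ} hφ hψ V W h m := by simp [hφ V W h m, hψ V W h m]
  neg_mem' {φ} hφ V W h m := by simp [hφ V W h m]

noncomputable instance homSecModule (U : C.Opens) : Module Γ(C, U) (homSec M N U) where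
  smul r φ := ⟨fun V => fres V.2 r • φ.1 V, fun V W h m => by
    simp only [LinearMap.smul_apply, res_smul, fres_fres]
    rw [φ.2 V W h m]⟩
  one_smul φ := Subtype.ext (funext fun V => LinearMap.ext fun m => by
    change fres V.2 1 • φ.1 V m = _; simp)
  mul_smul r s φ := Subtype.ext (funext fun V => LinearMap.ext fun m => by
    change fres V.2 (r * s) • φ.1 V m = fres V.2 r • fres V.2 s • φ.1 V m; simp [mul_smul])
  smul_zero r := Subtype.ext (funext fun V => LinearMap.ext fun m => by
    change fres V.2 r • (0 : Γ(N, V.1)) = 0; simp)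
  smul_add r φ ψ := Subtype.ext (funext fun V => LinearMap.ext fun m => by
    change fres V.2 r • (φ.1 V m + ψ.1 V m) = fres V.2 r • φ.1 V m + fres V.2 r • ψ.1 V m; simp)
  add_smul r s φ := Subtype.ext (funext fun V => LinearMap.ext fun m => by
    change fres V.2 (r + s) • φ.1 V m = fres V.2 r • φ.1 V m + fres V.2 s • φ.1 V m
    simp [add_smul])
  zero_smul φ := Subtype.ext (funext fun V => LinearMap.ext fun m => by
    change fres V.2 0 • φ.1 V m = 0; simp)

variable {M N} in
lemma homSec_ext {U : C.Opens} {φ ψ : homSec M N U}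
    (h : ∀ (V : C.Opens) (hV : V ≤ U) (m : Γ(M, V)), φ.1 ⟨V, hV⟩ m = ψ.1 ⟨V, hV⟩ m) : φ = ψ :=
  Subtype.ext (funext fun V => LinearMap.ext fun m => h V.1 V.2 m)

variable {M N} in
lemma homSec_sep {ι : Type u} (U : ι → C.Opens) {T : C.Opens} (hT : T ≤ iSup U)
    (hUT : ∀ i, U i ≤ T) (φ ψ : homSec M N T)
    (h : ∀ (i) (V : C.Opens) (hV : V ≤ U i) (m : Γ(M, V)),
      φ.1 ⟨V, hV.trans (hUT i)⟩ m = ψ.1 ⟨V, hV.trans (hUT i)⟩ m) : φ = ψ := by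
  refine homSec_ext fun V hV m => ?_
  refine sep N (fun i => V ⊓ U i) (fun i => inf_le_left) ?_ _ _ fun i => ?_
  · rw [← inf_iSup_eq]; exact le_inf le_rfl (hV.trans hT)
  · rw [φ.2 ⟨V, hV⟩ ⟨V ⊓ U i, inf_le_left.trans hV⟩ inf_le_left m,
      ψ.2 ⟨V, hV⟩ ⟨V ⊓ U i, inf_le_left.trans hV⟩ inf_le_left m]
    exact h i _ inf_le_right _

variable {M N} in
lemma homSec_glue {ι : Type u} (U : ι → C.Opens) (φ : ∀ i, homSec M N (U i))
    (h : ∀ (i j) (V : C.Opens) (hi : V ≤ U i) (hj : V ≤ U j) (m : Γ(M, V)),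
      (φ i).1 ⟨V, hi⟩ m = (φ j).1 ⟨V, hj⟩ m) :
    ∃ ψ : homSec M N (iSup U), ∀ (i) (V : C.Opens) (hV : V ≤ U i) (m : Γ(M, V)),
      ψ.1 ⟨V, hV.trans (le_iSup U i)⟩ m = (φ i).1 ⟨V, hV⟩ m := by
  have cov : ∀ V : {V : C.Opens // V ≤ iSup U}, V.1 ≤ ⨆ i, V.1 ⊓ U i := fun V => by
    rw [← inf_iSup_eq]; exact le_inf le_rfl V.2
  have key : ∀ (V : {V : C.Opens // V ≤ iSup U}) (m : Γ(M, V.1)), ∃ n : Γ(N, V.1),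
      ∀ i, res N (inf_le_left : V.1 ⊓ U i ≤ V.1) n
        = (φ i).1 ⟨V.1 ⊓ U i, inf_le_right⟩ (res M inf_le_left m) := fun V m => by
    refine glue N (fun i => V.1 ⊓ U i) (fun i => inf_le_left) (cov V)
      (fun i => (φ i).1 ⟨V.1 ⊓ U i, inf_le_right⟩ (res M inf_le_left m)) fun i j => ?_
    rw [(φ i).2 ⟨V.1 ⊓ U i, inf_le_right⟩ ⟨(V.1 ⊓ U i) ⊓ (V.1 ⊓ U j),
        inf_le_left.trans inf_le_right⟩ inf_le_left,
      (φ j).2 ⟨V.1 ⊓ U j, inf_le_right⟩ ⟨(V.1 ⊓ U i) ⊓ (V.1 ⊓ U j),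
        inf_le_right.trans inf_le_right⟩ inf_le_right, res_res, res_res]
    exact h i j _ _ _ _
  choose n hn using key
  have uniq : ∀ (V : {V : C.Opens // V ≤ iSup U}) (m : Γ(M, V.1)) (t : Γ(N, V.1)),
      (∀ i, res N (inf_le_left : V.1 ⊓ U i ≤ V.1) t
        = (φ i).1 ⟨V.1 ⊓ U i, inf_le_right⟩ (res M inf_le_left m)) → n V m = t :=
    fun V m t ht => sep N (fun i => V.1 ⊓ U i) (fun i => inf_le_left) (cov V) _ _
      fun i => (hn V m i).trans (ht i).symm
  let ψ : ∀ V : {V : C.Opens // V ≤ iSup U}, Γ(M, V.1) →ₗ[Γ(C, V.1)] Γ(N, V.1) := fun V =>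
    { toFun := n V
      map_add' := fun a b => uniq V _ _ fun i => by simp [hn]
      map_smul' := fun r a => uniq V _ _ fun i => by simp [hn, res_smul] }
  have hψ : ∀ (i) (V : C.Opens) (hV : V ≤ U i) (m : Γ(M, V)),
      n ⟨V, hV.trans (le_iSup U i)⟩ m = (φ i).1 ⟨V, hV⟩ m := fun i V hV m => by
    refine uniq _ _ _ fun j => ?_
    rw [(φ i).2 ⟨V, hV⟩ ⟨V ⊓ U j, inf_le_left.trans hV⟩ inf_le_left]
    exact h i j _ _ _ _
  refine ⟨⟨ψ, fun V W hWV m => (uniq W _ _ fun i => ?_).symm⟩, hψ⟩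
  change res N _ (res N _ (n V m)) = _
  have e : res N (inf_le_left : W.1 ⊓ U i ≤ W.1) (res N hWV (n V m))
      = res N (inf_le_inf_right (U i) hWV) (res N inf_le_left (n V m)) := by
    rw [res_res, res_res]
  rw [e, hn, (φ i).2 ⟨V.1 ⊓ U i, inf_le_right⟩ ⟨W.1 ⊓ U i, inf_le_right⟩, res_res, res_res]

/-- The restriction `Hom(M|_U, N|_U) → Hom(M|_V, N|_V)`. -/
noncomputable def homRes {U V : C.Opens} (h : V ≤ U) : homSec M N U →+ homSec M N V where
  toFun φ := ⟨fun W => φ.1 ⟨W.1, W.2.trans h⟩, fun W W' k m =>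
    φ.2 ⟨W.1, W.2.trans h⟩ ⟨W'.1, W'.2.trans h⟩ k m⟩
  map_zero' := rfl
  map_add' _ _ := rfl

/-- The sheaf of homomorphisms `ℋom(M, N)`. -/
noncomputable def homSheaf : C.Modules :=
  ModData.toModules
    { sec := fun U => homSec M N U
      res := homRes M N
      res_id := fun _ => rfl
      res_res := fun _ _ _ => rfl
      sep := fun U s t h => homSec_sep U le_rfl (le_iSup U) s t fun i V hV m =>
        congr(($(h i)).1 ⟨V, hV⟩ m)
      glue := fun U s h => by
        obtain ⟨t, ht⟩ := homSec_glue U s fun i j V hi hj m =>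
          congr(($(h i j)).1 ⟨V, le_inf hi hj⟩ m)
        exact ⟨t, fun i => homSec_ext fun V hV m => ht i V hV m⟩
      res_smul := fun h r φ => homSec_ext fun V hV m => by
        change fres (hV.trans h) r • φ.1 ⟨V, hV.trans h⟩ m =
            fres hV (fres h r) • φ.1 ⟨V, hV.trans h⟩ m
        rw [fres_fres] }

variable {M N}

/-- The value of a section `φ` of `ℋom(M, N)` over `U` on a section of `M` over `V ⊆ U`. -/
noncomputable def ev {U V : C.Opens} (φ : Γ(homSheaf M N, U)) (h : V ≤ U) :
    Γ(M, V) →ₗ[Γ(C, V)] Γ(N, V) :=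
  (show homSec M N U from φ).1 ⟨V, h⟩

lemma ev_res {U V W : C.Opens} (φ : Γ(homSheaf M N, U)) (h : V ≤ U) (k : W ≤ V) (m : Γ(M, W)) :
    ev (res _ h φ) k m = ev φ (k.trans h) m := rfl

lemma ev_add {U V : C.Opens} (φ ψ : Γ(homSheaf M N, U)) (h : V ≤ U) (m : Γ(M, V)) :
    ev (φ + ψ) h m = ev φ h m + ev ψ h m := rfl

lemma ev_smul {U V : C.Opens} (r : Γ(C, U)) (φ : Γ(homSheaf M N, U)) (h : V ≤ U) (m : Γ(M, V)) :
    ev (r • φ) h m = fres h r • ev φ h m := rfl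

lemma res_ev {U V W : C.Opens} (φ : Γ(homSheaf M N, U)) (h : V ≤ U) (k : W ≤ V) (m : Γ(M, V)) :
    res N k (ev φ h m) = ev φ (k.trans h) (res M k m) :=
  (show homSec M N U from φ).2 ⟨V, h⟩ ⟨W, k.trans h⟩ k m

end SheafHom


section HomMap

variable {C : Scheme.{u}} (M : C.Modules) {N N' : C.Modules}

/-- The morphism `ℋom(M, N) ⟶ ℋom(M, N')` given by composition with `f : N ⟶ N'`. -/
noncomputable def homSheafMap (f : N ⟶ N') : homSheaf M N ⟶ homSheaf M N' :=
  homMk (fun U =>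
    { toFun := fun φ => (show homSec M N' U from
        ⟨fun V => (appLin f V.1).comp (ev φ V.2), fun V W h m => by
          change res N' h (f.app V.1 (ev φ V.2 m)) = f.app W.1 (ev φ W.2 (res M h m))
          rw [← app_res, res_ev]⟩)
      map_add' := fun φ ψ => homSec_ext fun V hV m =>
        map_add (appLin f V) (ev φ hV m) (ev ψ hV m)
      map_smul' := fun r φ => homSec_ext fun V hV m =>
        map_smul (appLin f V) (fres hV r) (ev φ hV m) })
    (fun _ _ => rfl)

lemma ev_homSheafMap (f : N ⟶ N') {U V : C.Opens} (φ : Γ(homSheaf M N, U)) (h : V ≤ U)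
    (m : Γ(M, V)) : ev ((homSheafMap M f).app U φ) h m = f.app V (ev φ h m) := rfl

end HomMap

section StalkEv

variable {C : Scheme.{u}} {M N : C.Modules}

lemma stalkEv_aux (x : C) (s : (homSheaf M N).presheaf.stalk x) (m : M.presheaf.stalk x) :
    ∃ n : N.presheaf.stalk x, ∀ (U : C.Opens) (hU : x ∈ U) (φ : Γ(homSheaf M N, U)) (a : Γ(M, U)),
      (homSheaf M N).presheaf.germ U x hU φ = s → M.presheaf.germ U x hU a = m →
      N.presheaf.germ U x hU (ev φ le_rfl a) = n := by
  obtain ⟨U, hU, φ, rfl⟩ := TopCat.Presheaf.exists_germ_eq _ s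
  obtain ⟨V, hV, a, rfl⟩ := TopCat.Presheaf.exists_germ_eq _ m
  refine ⟨N.presheaf.germ (U ⊓ V) x ⟨hU, hV⟩ (ev φ inf_le_left (res M inf_le_right a)), ?_⟩
  intro T hT ψ b hψ hb
  obtain ⟨W, hW, i, j, e⟩ := TopCat.Presheaf.germ_eq _ x hT hU _ _ hψ
  obtain ⟨W', hW', i', j', e'⟩ := TopCat.Presheaf.germ_eq _ x hT hV _ _ hb
  have hS : x ∈ W ⊓ W' := ⟨hW, hW'⟩
  have hST : W ⊓ W' ≤ T := inf_le_left.trans i.le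
  have hSU : W ⊓ W' ≤ U := inf_le_left.trans j.le
  have hSV : W ⊓ W' ≤ V := inf_le_right.trans j'.le
  rw [← germ_res N hST x hS, ← germ_res N (le_inf hSU hSV) x hS, res_ev, res_ev, res_res]
  have e1 : res _ i.le ψ = res _ j.le φ := e
  have e2 : res _ i'.le b = res _ j'.le a := e'
  have e3 : res M hST b = res M hSV a := by
    rw [← res_res M i'.le inf_le_right, e2, res_res]
  rw [e3]
  have e4 := congr(ev (V := W ⊓ W') $e1 inf_le_left (res M hSV a))
  rw [ev_res, ev_res] at e4
  exact congr(N.presheaf.germ _ x hS $e4)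

/-- The germ at `x` of a homomorphism applied to a germ at `x`, as a function. -/
noncomputable def stalkEvFun (x : C) (s : (homSheaf M N).presheaf.stalk x)
    (m : M.presheaf.stalk x) : N.presheaf.stalk x := (stalkEv_aux x s m).choose

lemma stalkEvFun_germ (x : C) {U : C.Opens} (hU : x ∈ U) (φ : Γ(homSheaf M N, U)) (a : Γ(M, U)) :
    stalkEvFun x ((homSheaf M N).presheaf.germ U x hU φ) (M.presheaf.germ U x hU a) =
      N.presheaf.germ U x hU (ev φ le_rfl a) :=
  ((stalkEv_aux x _ _).choose_spec U hU φ a rfl rfl).symm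

/-- A germ is represented on any sufficiently small neighbourhood. -/
lemma exists_germ (M : C.Modules) (x : C) (m : M.presheaf.stalk x) :
    ∃ U : C.Opens, x ∈ U ∧ ∀ (V : C.Opens) (hV : x ∈ V), V ≤ U →
      ∃ a : Γ(M, V), M.presheaf.germ V x hV a = m := by
  obtain ⟨U, hU, a, rfl⟩ := TopCat.Presheaf.exists_germ_eq _ m
  exact ⟨U, hU, fun V hV h => ⟨res M h a, germ_res M h x hV a⟩⟩

/-- The biadditive evaluation `ℋom(M, N)_x × M_x → N_x`. -/
noncomputable def stalkEv (x : C) :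
    (homSheaf M N).presheaf.stalk x →+ M.presheaf.stalk x →+ N.presheaf.stalk x :=
  AddMonoidHom.mk' (fun s => AddMonoidHom.mk' (stalkEvFun x s) fun m m' => by
      obtain ⟨U, hU, kφ⟩ := exists_germ _ x s
      obtain ⟨V, hV, ka⟩ := exists_germ _ x m
      obtain ⟨V', hV', ka'⟩ := exists_germ _ x m'
      have hW : x ∈ U ⊓ V ⊓ V' := ⟨⟨hU, hV⟩, hV'⟩
      obtain ⟨φ, rfl⟩ := kφ (U ⊓ V ⊓ V') hW (inf_le_left.trans inf_le_left)
      obtain ⟨a, rfl⟩ := ka (U ⊓ V ⊓ V') hW (inf_le_left.trans inf_le_right)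
      obtain ⟨a', rfl⟩ := ka' (U ⊓ V ⊓ V') hW inf_le_right
      rw [← map_add, stalkEvFun_germ, stalkEvFun_germ, stalkEvFun_germ, map_add, map_add])
    fun s s' => AddMonoidHom.ext fun m => by
      obtain ⟨U, hU, kφ⟩ := exists_germ _ x s
      obtain ⟨V, hV, kφ'⟩ := exists_germ _ x s'
      obtain ⟨V', hV', ka⟩ := exists_germ _ x m
      have hW : x ∈ U ⊓ V ⊓ V' := ⟨⟨hU, hV⟩, hV'⟩
      obtain ⟨φ, rfl⟩ := kφ (U ⊓ V ⊓ V') hW (inf_le_left.trans inf_le_left)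
      obtain ⟨φ', rfl⟩ := kφ' (U ⊓ V ⊓ V') hW (inf_le_left.trans inf_le_right)
      obtain ⟨a, rfl⟩ := ka (U ⊓ V ⊓ V') hW inf_le_right
      change stalkEvFun x _ _ = stalkEvFun x _ _ + stalkEvFun x _ _
      rw [← map_add, stalkEvFun_germ, stalkEvFun_germ, stalkEvFun_germ, ev_add, map_add]

lemma stalkEv_germ (x : C) {U : C.Opens} (hU : x ∈ U) (φ : Γ(homSheaf M N, U)) (a : Γ(M, U)) :
    stalkEv x ((homSheaf M N).presheaf.germ U x hU φ) (M.presheaf.germ U x hU a) =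
      N.presheaf.germ U x hU (ev φ le_rfl a) := stalkEvFun_germ x hU φ a

lemma stalkEv_smul (x : C) (s : (homSheaf M N).presheaf.stalk x) {U : C.Opens} (hU : x ∈ U)
    (r : Γ(C, U)) (m : M.presheaf.stalk x) :
    stalkEv x s (C.presheaf.germ U x hU r • m) = C.presheaf.germ U x hU r • stalkEv x s m := by
  obtain ⟨V, hV, kφ⟩ := exists_germ _ x s
  obtain ⟨V', hV', ka⟩ := exists_germ _ x m
  have hW : x ∈ U ⊓ V ⊓ V' := ⟨⟨hU, hV⟩, hV'⟩
  obtain ⟨φ, rfl⟩ := kφ (U ⊓ V ⊓ V') hW (inf_le_left.trans inf_le_right)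
  obtain ⟨a, rfl⟩ := ka (U ⊓ V ⊓ V') hW inf_le_right
  rw [← germ_fres (inf_le_left.trans inf_le_left : U ⊓ V ⊓ V' ≤ U) x hW, ← germ_smul,
    stalkEv_germ, stalkEv_germ, map_smul, germ_smul]

end StalkEv

section Principal

variable {C : Scheme.{u}} [IrreducibleSpace C]

/-- The generic point lies in every nonempty open set. -/
lemma generic_mem {U : C.Opens} {x : C} (hx : x ∈ U) : genericPoint C ∈ U :=
  (genericPoint_specializes x).mem_open U.isOpen hx

variable (M N : C.Modules)

/-- The generic stalk `M_η`, the group of rational sections of `M`. -/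
abbrev RatStalk : Type u := M.presheaf.stalk (genericPoint C)

/-- The map `M_x → M_η`. -/
noncomputable def spec (x : C) : M.presheaf.stalk x →+ RatStalk M :=
  (M.presheaf.stalkSpecializes (genericPoint_specializes x)).hom

lemma spec_germ {U : C.Opens} (x : C) (hx : x ∈ U) (m : Γ(M, U)) :
    spec M x (M.presheaf.germ U x hx m) = M.presheaf.germ U (genericPoint C) (generic_mem hx) m :=
  TopCat.Presheaf.germ_stalkSpecializes_apply M.presheaf hx (genericPoint_specializes x) m

/-- The rational sections of `M` that are regular at `x`. -/
noncomputable def regAt (x : C) : AddSubgroup (RatStalk M) := (spec M x).range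

lemma smul_mem_regAt {U : C.Opens} (x : C) (hx : x ∈ U) (r : Γ(C, U)) {m : RatStalk M}
    (hm : m ∈ regAt M x) :
    C.presheaf.germ U (genericPoint C) (generic_mem hx) r • m ∈ regAt M x := by
  obtain ⟨m, rfl⟩ := hm
  obtain ⟨V, hV, ka⟩ := exists_germ _ x m
  have hW : x ∈ U ⊓ V := ⟨hx, hV⟩
  obtain ⟨a, rfl⟩ := ka (U ⊓ V) hW inf_le_right
  refine ⟨M.presheaf.germ _ x hW (fres (inf_le_left : U ⊓ V ≤ U) r • a), ?_⟩
  rw [spec_germ, spec_germ, germ_smul, germ_fres]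

/-- Sections of `Rat(M)` over `U`: elements of the generic stalk if `U` is nonempty, and `0`
otherwise. -/
def RatSec (U : C.Opens) : Type u := PLift (genericPoint C ∈ U) → RatStalk M

noncomputable instance (U : C.Opens) : AddCommGroup (RatSec M U) :=
  inferInstanceAs (AddCommGroup (PLift (genericPoint C ∈ U) → RatStalk M))

noncomputable instance (U : C.Opens) : Module Γ(C, U) (RatSec M U) where
  smul r f := fun h => C.presheaf.germ U (genericPoint C) h.down r • f h
  one_smul f := funext fun h => by
    change C.presheaf.germ U (genericPoint C) h.down 1 • f h = f h; simp
  mul_smul r s f := funext fun h => by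
    change C.presheaf.germ U (genericPoint C) h.down (r * s) • f h =
      C.presheaf.germ U (genericPoint C) h.down r • C.presheaf.germ U (genericPoint C) h.down s • f h
    simp [mul_smul]
  smul_zero r := funext fun h => smul_zero (C.presheaf.germ U (genericPoint C) h.down r)
  smul_add r f g := funext fun h => smul_add (C.presheaf.germ U (genericPoint C) h.down r) _ _
  add_smul r s f := funext fun h => by
    change C.presheaf.germ U (genericPoint C) h.down (r + s) • f h =
      C.presheaf.germ U (genericPoint C) h.down r • f h +
      C.presheaf.germ U (genericPoint C) h.down s • f h
    simp [add_smul]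
  zero_smul f := funext fun h => by
    change C.presheaf.germ U (genericPoint C) h.down 0 • f h = 0; simp

/-- Restriction of rational sections. -/
noncomputable def ratRes {U V : C.Opens} (h : V ≤ U) : RatSec M U →+ RatSec M V where
  toFun f := fun k => f ⟨h k.down⟩
  map_zero' := rfl
  map_add' _ _ := rfl

lemma ratRes_smul {U V : C.Opens} (h : V ≤ U) (r : Γ(C, U)) (f : RatSec M U) :
    ratRes M h (r • f) = fres h r • ratRes M h f := funext fun k => by
  change C.presheaf.germ U _ (h k.down) r • f _ = C.presheaf.germ V _ k.down (fres h r) • f _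
  rw [germ_fres]

/-- The sheaf of rational sections `Rat(M)`: the constant sheaf with value `M_η`. -/
noncomputable def ratMod : ModData C where
  sec := RatSec M
  res := ratRes M
  res_id := fun _ => rfl
  res_res := fun _ _ _ => rfl
  sep := fun _ _ _ h => funext fun ⟨k⟩ => by
    obtain ⟨i, hi⟩ := Opens.mem_iSup.1 k
    exact congr($(h i) ⟨hi⟩)
  glue := fun U s h => by
    refine ⟨fun k => s (Opens.mem_iSup.1 k.down).choose ⟨(Opens.mem_iSup.1 k.down).choose_spec⟩,
      fun i => funext fun ⟨k⟩ => ?_⟩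
    exact congr($(h _ i) ⟨⟨(Opens.mem_iSup.1 (le_iSup U i k)).choose_spec, k⟩⟩)
  res_smul := ratRes_smul M

/-- The sheaf of rational sections `Rat(M)` as an `𝒪`-module. -/
noncomputable def rat : C.Modules := (ratMod M).toModules

/-- The map `M(U) → Rat(M)(U)`. -/
noncomputable def toRat : M ⟶ rat M :=
  homMk (fun U =>
    { toFun := fun s => (show RatSec M U from fun h => M.presheaf.germ U _ h.down s)
      map_add' := fun s t => funext fun _ => map_add _ s t
      map_smul' := fun r s => funext fun h => germ_smul M _ h.down r s })
    fun h s => funext fun k => germ_res M h _ k.down s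

/-- Principal parts on `U` with values in `M`: families `(p_x)` with `p_x ∈ M_η / M_x`, `x ∈ U`,
that are locally given by a single rational section. These are the sections
over `U` of the quotient sheaf `Rat(M) / M`. -/
noncomputable def prinSec (U : C.Opens) : AddSubgroup (∀ x : U, RatStalk M ⧸ regAt M x.1) where
  carrier := {p | ∀ x : U, ∃ (V : C.Opens) (hV : V ≤ U) (β : RatStalk M), x.1 ∈ V ∧
    ∀ (y : C) (hy : y ∈ V), p ⟨y, hV hy⟩ = QuotientAddGroup.mk β}
  zero_mem' x := ⟨U, le_rfl, 0, x.2, fun _ _ => rfl⟩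
  add_mem' {p q} hp hq x := by
    obtain ⟨V, hV, β, hx, h⟩ := hp x
    obtain ⟨V', hV', β', hx', h'⟩ := hq x
    exact ⟨V ⊓ V', inf_le_left.trans hV, β + β', ⟨hx, hx'⟩, fun y hy => by
      rw [Pi.add_apply, h y hy.1, h' y hy.2]; rfl⟩
  neg_mem' {p} hp x := by
    obtain ⟨V, hV, β, hx, h⟩ := hp x
    exact ⟨V, hV, -β, hx, fun y hy => by rw [Pi.neg_apply, h y hy]; rfl⟩

/-- Restriction of principal parts. -/
noncomputable def prinRes {U V : C.Opens} (h : V ≤ U) : prinSec M U →+ prinSec M V where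
  toFun p := ⟨fun x => p.1 ⟨x.1, h x.2⟩, fun x => by
    obtain ⟨T, hT, β, hx, k⟩ := p.2 ⟨x.1, h x.2⟩
    exact ⟨T ⊓ V, inf_le_right, β, ⟨hx, x.2⟩, fun y hy => k y hy.1⟩⟩
  map_zero' := rfl
  map_add' _ _ := rfl

/-- The sheaf of principal parts `Prin(M) = Rat(M) / M`. -/
noncomputable def prinAb : AbData C.toTopCat where
  sec U := prinSec M U
  res := prinRes M
  res_id := fun _ => rfl
  res_res := fun _ _ _ => rfl
  sep := fun _ _ _ h => Subtype.ext <| funext fun ⟨x, hx⟩ => by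
    obtain ⟨i, hi⟩ := Opens.mem_iSup.1 hx
    exact congr(($(h i)).1 ⟨x, hi⟩)
  glue := fun U s h => by
    have key : ∀ (x : C) (i j) (hi : x ∈ U i) (hj : x ∈ U j), (s i).1 ⟨x, hi⟩ = (s j).1 ⟨x, hj⟩ :=
      fun x i j hi hj => congr(($(h i j)).1 ⟨x, hi, hj⟩)
    refine ⟨⟨fun x => (s (Opens.mem_iSup.1 x.2).choose).1
      ⟨x.1, (Opens.mem_iSup.1 x.2).choose_spec⟩, fun x => ?_⟩,
      fun i => Subtype.ext <| funext fun x => key _ _ _ _ _⟩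
    obtain ⟨i, hi⟩ := Opens.mem_iSup.1 x.2
    obtain ⟨V, hV, β, hx, k⟩ := (s i).2 ⟨x.1, hi⟩
    exact ⟨V, hV.trans (le_iSup U i), β, hx, fun y hy => by
      rw [← k y hy]; exact key y _ i _ _⟩

/-- The group `Prin(M)` of global principal parts with values in `M`. -/
abbrev Prin : Type u := prinSec M ⊤

/-- The map `Rat(M)(U) → Prin(M)(U)`. -/
noncomputable def ratToPrin (U : C.Opens) : RatSec M U →+ prinSec M U where
  toFun f := ⟨fun x => QuotientAddGroup.mk (f ⟨generic_mem x.2⟩),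
    fun x => ⟨U, le_rfl, f ⟨generic_mem x.2⟩, x.2, fun _ _ => rfl⟩⟩
  map_zero' := rfl
  map_add' _ _ := rfl

variable {M N}

/-- The map on generic stalks. -/
noncomputable def ratStalkMap (f : M ⟶ N) : RatStalk M →+ RatStalk N :=
  ((TopCat.Presheaf.stalkFunctor Ab.{u} (genericPoint C)).map f.mapPresheaf).hom

lemma ratStalkMap_germ (f : M ⟶ N) {U : C.Opens} (h : genericPoint C ∈ U) (m : Γ(M, U)) :
    ratStalkMap f (M.presheaf.germ U _ h m) = N.presheaf.germ U _ h (f.app U m) :=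
  TopCat.Presheaf.stalkFunctor_map_germ_apply U _ h f.mapPresheaf m

lemma regAt_le_comap (f : M ⟶ N) (x : C) :
    regAt M x ≤ (regAt N x).comap (ratStalkMap f) := by
  intro m hm
  obtain ⟨m, rfl⟩ := hm
  obtain ⟨U, hU, a, rfl⟩ := TopCat.Presheaf.exists_germ_eq _ m
  refine ⟨N.presheaf.germ U x hU (f.app U a), ?_⟩
  rw [spec_germ]
  erw [spec_germ M x hU a]
  rw [ratStalkMap_germ]

/-- The map `Prin(M) → Prin(N)` induced by `f : M ⟶ N`. -/
noncomputable def prinMap (f : M ⟶ N) : Prin M →+ Prin N where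
  toFun p := ⟨fun x => QuotientAddGroup.map (regAt M x.1) (regAt N x.1) (ratStalkMap f)
      (regAt_le_comap f x.1) (p.1 x), fun x => by
    obtain ⟨V, hV, β, hx, h⟩ := p.2 x
    exact ⟨V, hV, ratStalkMap f β, hx, fun y hy => by
      beta_reduce; rw [h y hy]; rfl⟩⟩
  map_zero' := Subtype.ext <| funext fun x => map_zero _
  map_add' _ _ := Subtype.ext <| funext fun x => map_add _ _ _

/-- A class in `ℋom(M, N)_η / ℋom(M, N)_x` induces a map `M_x → N_η / N_x`. -/
noncomputable def prinEv (x : C) : RatStalk (homSheaf M N) ⧸ regAt (homSheaf M N) x →+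
    M.presheaf.stalk x →+ RatStalk N ⧸ regAt N x :=
  QuotientAddGroup.lift _
    (AddMonoidHom.mk' (fun s => ((QuotientAddGroup.mk' (regAt N x)).comp
      (stalkEv (genericPoint C) s)).comp (spec M x)) fun s t => by ext m; simp)
    fun s hs => by
      obtain ⟨s, rfl⟩ := hs
      ext m
      obtain ⟨V, hV, kφ⟩ := exists_germ _ x s
      obtain ⟨V', hV', ka⟩ := exists_germ _ x m
      have hW : x ∈ V ⊓ V' := ⟨hV, hV'⟩
      obtain ⟨φ, rfl⟩ := kφ (V ⊓ V') hW inf_le_left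
      obtain ⟨a, rfl⟩ := ka (V ⊓ V') hW inf_le_right
      refine (QuotientAddGroup.eq_zero_iff _).2 ?_
      refine ⟨N.presheaf.germ _ x hW (ev φ le_rfl a), ?_⟩
      simp only [spec_germ, stalkEv_germ]

lemma prinEv_mk (x : C) (s : RatStalk (homSheaf M N)) (m : M.presheaf.stalk x) :
    prinEv x (QuotientAddGroup.mk s) m = QuotientAddGroup.mk (stalkEv _ s (spec M x m)) := rfl

end Principal


section Symmetric

variable {C : Scheme.{u}} (F L : C.Modules)

/-- The sheaf `F^* ⊗ L`, realised as `ℋom(F, L)`. -/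
noncomputable abbrev twistedDual : C.Modules := homSheaf F L

/-- The sheaf `L^{-1} ⊗ F ⊗ F`, realised as `ℋom(F^* ⊗ L, F)`: the tensor `λ ⊗ f ⊗ g` is
`φ ↦ λ(φ(f)) g`. -/
noncomputable abbrev tensorSheaf : C.Modules := homSheaf (twistedDual F L) F

/-- Sections `φ` of `L^{-1} ⊗ F ⊗ F` over `U` that equal their transpose:
`⟨φ(a), b⟩ = ⟨φ(b), a⟩` for all local sections `a, b` of `F^* ⊗ L`. -/
noncomputable def symSec (U : C.Opens) : Submodule Γ(C, U) Γ(tensorSheaf F L, U) where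
  carrier := {φ | ∀ (V : C.Opens) (h : V ≤ U) (a b : Γ(twistedDual F L, V)),
    ev b le_rfl (ev φ h a) = ev a le_rfl (ev φ h b)}
  zero_mem' V h a b := by
    change ev b le_rfl 0 = ev a le_rfl 0
    rw [map_zero, map_zero]
  add_mem' {φ ψ} hφ hψ V h a b := by
    rw [ev_add, ev_add, map_add, map_add, hφ V h a b, hψ V h a b]
  smul_mem' r φ hφ V h a b := by
    rw [ev_smul, ev_smul, map_smul, map_smul, hφ V h a b]

/-- Restriction of symmetric sections. -/
noncomputable def symRes {U V : C.Opens} (h : V ≤ U) : symSec F L U →+ symSec F L V where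
  toFun φ := ⟨res _ h φ.1, fun W k a b => φ.2 W (k.trans h) a b⟩
  map_zero' := rfl
  map_add' _ _ := rfl

/-- The sheaf `L^{-1} ⊗ Sym² F` of symmetric sections of `L^{-1} ⊗ F ⊗ F`. -/
noncomputable def symSheaf : C.Modules :=
  ModData.toModules
    { sec := fun U => symSec F L U
      res := symRes F L
      res_id := fun _ => rfl
      res_res := fun _ _ _ => rfl
      sep := fun U _ _ h => Subtype.ext <| sep _ U (le_iSup U) le_rfl _ _
        fun i => congr(($(h i)).1)
      glue := fun U s h => by
        obtain ⟨t, ht⟩ := glue (tensorSheaf F L) U (le_iSup U) le_rfl (fun i => (s i).1)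
          fun i j => congr(($(h i j)).1)
        refine ⟨⟨t, fun V hV a b => ?_⟩, fun i => Subtype.ext (ht i)⟩
        refine sep L (fun i => V ⊓ U i) (fun i => inf_le_left) ?_ _ _ fun i => ?_
        · rw [← inf_iSup_eq]; exact le_inf le_rfl hV
        · have e := (s i).2 (V ⊓ U i) inf_le_right (res _ inf_le_left a) (res _ inf_le_left b)
          rw [← ht i, ev_res, ev_res, ev_res, ev_res] at e
          rw [res_ev, res_ev, res_ev, res_ev]
          exact e
      res_smul := fun h r φ => Subtype.ext (res_smul _ h r φ.1) }

/-- The inclusion `L^{-1} ⊗ Sym² F ⟶ L^{-1} ⊗ F ⊗ F`. -/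
noncomputable def symIncl : symSheaf F L ⟶ tensorSheaf F L :=
  homMk (fun U => (symSec F L U).subtype) (fun _ _ => rfl)

end Symmetric

section Extension

variable {C : Scheme.{u}} [IrreducibleSpace C] {G F : C.Modules} (q : Prin (homSheaf G F))

/-- The sections over `U` of
`W_q = {(f, φ) ∈ Rat(F) ⊕ G : f mod F = q(φ) in Prin(F)}`. -/
noncomputable def extSec (U : C.Opens) : Submodule Γ(C, U) (RatSec F U × Γ(G, U)) where
  carrier := {w | ∀ (x : C) (hx : x ∈ U), (QuotientAddGroup.mk (w.1 ⟨generic_mem hx⟩) :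
    RatStalk F ⧸ regAt F x) = prinEv x (q.1 ⟨x, trivial⟩) (G.presheaf.germ U x hx w.2)}
  zero_mem' x hx := by
    change (QuotientAddGroup.mk (0 : RatStalk F) : RatStalk F ⧸ regAt F x) =
      prinEv x _ (G.presheaf.germ U x hx 0)
    rw [map_zero, map_zero]; rfl
  add_mem' {v w} hv hw x hx := by
    change (QuotientAddGroup.mk (v.1 _ + w.1 _) : RatStalk F ⧸ regAt F x) =
      prinEv x _ (G.presheaf.germ U x hx (v.2 + w.2))
    rw [map_add, map_add, ← hv x hx, ← hw x hx]; rfl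
  smul_mem' r w hw x hx := by
    have hw := hw x hx
    change (QuotientAddGroup.mk (C.presheaf.germ U _ (generic_mem hx) r • w.1 _) :
      RatStalk F ⧸ regAt F x) = prinEv x _ (G.presheaf.germ U x hx (r • w.2))
    obtain ⟨s, hs⟩ := QuotientAddGroup.mk_surjective (q.1 ⟨x, trivial⟩)
    rw [← hs, prinEv_mk, spec_germ, QuotientAddGroup.eq] at hw ⊢
    rw [germ_smul, stalkEv_smul, ← smul_neg, ← smul_add]
    exact smul_mem_regAt F x hx r hw

/-- Restriction of sections of `W_q`. -/
noncomputable def extRes {U V : C.Opens} (h : V ≤ U) : extSec q U →+ extSec q V where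
  toFun w := ⟨(ratRes F h w.1.1, res G h w.1.2), fun x hx => by
    rw [germ_res]; exact w.2 x (h hx)⟩
  map_zero' := Subtype.ext (Prod.ext (map_zero (ratRes F h)) (map_zero (res G h)))
  map_add' v w := Subtype.ext (Prod.ext (map_add (ratRes F h) v.1.1 w.1.1)
    (map_add (res G h) v.1.2 w.1.2))

/-- The `𝒪`-module `W_q = {(f, φ) ∈ Rat(F) ⊕ G : f mod F = q(φ) in Prin(F)}`. -/
noncomputable def extSheaf : C.Modules :=
  ModData.toModules
    { sec := fun U => extSec q U
      res := extRes q
      res_id := fun w => Subtype.ext (Prod.ext rfl (res_id G w.1.2))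
      res_res := fun h k w => Subtype.ext (Prod.ext rfl (res_res G h k w.1.2))
      sep := fun U v w h => Subtype.ext <| Prod.ext
        ((ratMod F).sep U v.1.1 w.1.1 fun i => congr(($(h i)).1.1))
        (sep G U (le_iSup U) le_rfl _ _ fun i => congr(($(h i)).1.2))
      glue := fun U w h => by
        obtain ⟨f, hf⟩ := (ratMod F).glue U (fun i => (w i).1.1) fun i j => congr(($(h i j)).1.1)
        obtain ⟨φ, hφ⟩ := glue G U (le_iSup U) le_rfl (fun i => (w i).1.2)
          fun i j => congr(($(h i j)).1.2)
        refine ⟨⟨(f, φ), fun x hx => ?_⟩, fun i => Subtype.ext (Prod.ext (hf i) (hφ i))⟩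
        obtain ⟨i, hi⟩ := Opens.mem_iSup.1 hx
        have e := (w i).2 x hi
        rw [← hf i, ← hφ i, germ_res] at e
        exact e
      res_smul := fun h r w => Subtype.ext (Prod.ext (ratRes_smul F h r w.1.1)
        (res_smul G h r w.1.2)) }

variable {q}

/-- The first component `f ∈ Rat(F)(U)` of a section `(f, φ)` of `W_q`. -/
noncomputable def extFst {U : C.Opens} (w : Γ(extSheaf q, U)) : RatSec F U :=
  (show extSec q U from w).1.1

/-- The second component `φ ∈ G(U)` of a section `(f, φ)` of `W_q`. -/
noncomputable def extSnd {U : C.Opens} (w : Γ(extSheaf q, U)) : Γ(G, U) :=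
  (show extSec q U from w).1.2

variable (q)

/-- The map `F ⟶ W_q`, `f ↦ (f, 0)`. -/
noncomputable def extIncl : F ⟶ extSheaf q :=
  homMk (fun U =>
    { toFun := fun f => (show extSec q U from
        ⟨((fun h => F.presheaf.germ U _ h.down f : RatSec F U), 0), fun x hx => by
          rw [map_zero, map_zero, QuotientAddGroup.eq_zero_iff]
          exact ⟨F.presheaf.germ U x hx f, spec_germ F x hx f⟩⟩)
      map_add' := fun f g => Subtype.ext <| Prod.ext (funext fun h => map_add _ f g)
        (add_zero 0).symm
      map_smul' := fun r f => Subtype.ext <| Prod.ext (funext fun h => germ_smul F _ h.down r f)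
        (smul_zero r).symm })
    fun h f => Subtype.ext <| Prod.ext (funext fun k => germ_res F h _ k.down f)
      (map_zero (res G h)).symm

/-- The projection `W_q ⟶ G`, `(f, φ) ↦ φ`. -/
noncomputable def extProj : extSheaf q ⟶ G :=
  homMk (fun _ =>
    { toFun := extSnd
      map_add' := fun _ _ => rfl
      map_smul' := fun _ _ => rfl })
    fun _ _ => rfl

/-- The sequence `0 → F → W_q → G → 0`. -/
noncomputable def extSeq : ShortComplex C.Modules :=
  ShortComplex.mk (extIncl q) (extProj q) (Scheme.Modules.hom_ext _ _ fun _ => rfl)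

end Extension

section Cohomology

variable (C : Scheme.{u})

/-- Sheaves of abelian groups on `C`. -/
abbrev AbSheaf : Type (u + 1) := Sheaf (Opens.grothendieckTopology C) AddCommGrpCat.{u}

/-- The underlying sheaf of abelian groups of an `𝒪`-module. -/
noncomputable def toAb : C.Modules ⥤ AbSheaf C :=
  SheafOfModules.toSheaf C.ringCatSheaf

variable {C}

/-- The cohomology group `H¹(C, M)`. -/
abbrev H1 (M : C.Modules) : Type u := Sheaf.H ((toAb C).obj M) 1

/-- The map `H¹(C, M) → H¹(C, N)` induced by `f : M ⟶ N`. -/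
noncomputable def H1map {M N : C.Modules} (f : M ⟶ N) : H1 M →+ H1 N :=
  Sheaf.H.map ((toAb C).map f) 1

/-- The connecting map `H⁰(C, S₃) → H¹(C, S₁)` of a short exact sequence of sheaves of abelian
groups. -/
noncomputable def connecting {S : ShortComplex (AbSheaf C)}
    (hS : S.ShortExact) (s : S.X₃.obj.obj (op (⊤ : C.Opens))) : Sheaf.H S.X₁ 1 :=
  ((Sheaf.H.equiv₀ S.X₃ (Limits.isTerminalTop (α := C.Opens))).symm s).comp hS.extClass
    (zero_add 1)

/-- The sequence `0 → ℋom(S₃, S₁) → ℋom(S₃, S₂) → ℋom(S₃, S₃) → 0` of sheaves of abelian groups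
attached to `0 → S₁ → S₂ → S₃ → 0`. -/
noncomputable def homSeq (S : ShortComplex C.Modules) :
    ShortComplex (AbSheaf C) :=
  ShortComplex.mk ((toAb C).map (homSheafMap S.X₃ S.f)) ((toAb C).map (homSheafMap S.X₃ S.g)) (by
    refine Sheaf.hom_ext (NatTrans.ext (funext fun U => ?_))
    ext φ
    refine homSec_ext fun V hV m => ?_
    exact congr(($(S.zero)).app V (ev φ hV m)))

/-- The identity section of `ℋom(M, M)`. -/
noncomputable def idSec (M : C.Modules) : Γ(homSheaf M M, (⊤ : C.Opens)) :=
  (show homSec M M ⊤ from ⟨fun _ => LinearMap.id, fun _ _ _ _ => rfl⟩)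

/-- The class in `H¹(C, ℋom(S₃, S₁))` of an extension `0 → S₁ → S₂ → S₃ → 0`: the image of the
identity of `S₃` under the connecting map of the sequence obtained by applying `ℋom(S₃, -)`. -/
noncomputable def extensionClass {S : ShortComplex C.Modules} (hS : (homSeq S).ShortExact) :
    H1 (homSheaf S.X₃ S.X₁) :=
  connecting hS (idSec S.X₃)

variable [IrreducibleSpace C] (M : C.Modules)

/-- The sequence `0 → M → Rat(M) → Prin(M) → 0` of sheaves of abelian groups. -/
noncomputable def prinSeq : ShortComplex (AbSheaf C) where
  X₁ := (toAb C).obj M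
  X₂ := (toAb C).obj (rat M)
  X₃ := (prinAb M).sheaf
  f := (toAb C).map (toRat M)
  g := ⟨{ app := fun U => AddCommGrpCat.ofHom (ratToPrin M U.unop)
          naturality := fun _ _ _ => rfl }⟩
  zero := by
    refine Sheaf.hom_ext (NatTrans.ext (funext fun U => ?_))
    ext s
    refine Subtype.ext (funext fun x => ?_)
    exact (QuotientAddGroup.eq_zero_iff _).2 ⟨M.presheaf.germ U.unop x.1 x.2 s, spec_germ M _ _ s⟩

variable {M}

/-- The class `[p] ∈ H¹(C, M)` of a principal part `p ∈ Prin(M)`. -/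
noncomputable def prinClass (hM : (prinSeq M).ShortExact) (p : Prin M) : H1 M :=
  connecting hM p

end Cohomology

section Bundles

variable {C : Scheme.{u}}

/-- A local frame of `M` over `U`: sections over `U` that form a basis of `M(V)` over `𝒪(V)` for
every open `V ⊆ U`, in other words an isomorphism of `M|_U` with a free module. -/
def IsFrame (M : C.Modules) {U : C.Opens} {ι : Type} (e : ι → Γ(M, U)) : Prop :=
  ∀ (V : C.Opens) (h : V ≤ U),
    LinearIndependent Γ(C, V) (fun i => res M h (e i)) ∧
    Submodule.span Γ(C, V) (Set.range fun i => res M h (e i)) = ⊤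

/-- `M` is a vector bundle of rank `r`: it is locally free of rank `r`. -/
def IsVectorBundle (M : C.Modules) (r : ℕ) : Prop :=
  ∀ x : C, ∃ (U : C.Opens) (e : Fin r → Γ(M, U)), x ∈ U ∧ IsFrame M e

/-- `j : F ⟶ W` is a subbundle of rank `r`: locally, `F` has a frame of length `r` whose image
under `j` can be completed to a frame of `W`. -/
def IsSubbundle {F W : C.Modules} (j : F ⟶ W) (r : ℕ) : Prop :=
  ∀ x : C, ∃ (U : C.Opens) (s : ℕ) (e : Fin r → Γ(F, U)) (e' : Fin s → Γ(W, U)), x ∈ U ∧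
    IsFrame F e ∧ IsFrame W (Sum.elim (fun i => j.app U (e i)) e')

/-- The value `ω(v, w)` of the `L`-valued bilinear form on `W` given by a morphism
`ω : W ⟶ ℋom(W, L)`. -/
noncomputable def pairing {W L : C.Modules} (ω : W ⟶ homSheaf W L) {U : C.Opens}
    (v w : Γ(W, U)) : Γ(L, U) :=
  ev (ω.app U v) le_rfl w

/-- An `L`-valued symplectic form on `W`: a skew-symmetric bilinear form which is nondegenerate,
that is, which induces an isomorphism of `W` with `ℋom(W, L) = W^* ⊗ L`. -/
structure IsSymplectic {W L : C.Modules} (ω : W ⟶ homSheaf W L) : Prop where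
  skew : ∀ (U : C.Opens) (v w : Γ(W, U)), pairing ω v w = -pairing ω w v
  nondegenerate : IsIso ω

/-- A Lagrangian subbundle of a symplectic bundle of rank `2n`: an isotropic subbundle of
rank `n`. -/
structure IsLagrangian {W L F : C.Modules} (n : ℕ) (ω : W ⟶ homSheaf W L) (j : F ⟶ W) :
    Prop where
  subbundle : IsSubbundle j n
  isotropic : ∀ (U : C.Opens) (f g : Γ(F, U)), pairing ω (j.app U f) (j.app U g) = 0

end Bundles

section Standard

variable {C : Scheme.{u}} [IrreducibleSpace C] {F L : C.Modules}

/-- The principal part with values in `L^{-1} ⊗ F ⊗ F` underlying a symmetric principal part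
`p ∈ Prin(L^{-1} ⊗ Sym² F)`. -/
noncomputable abbrev symPrin (p : Prin (symSheaf F L)) : Prin (tensorSheaf F L) :=
  prinMap (symIncl F L) p

/-- The bundle `W_p = {(f, φ) ∈ Rat(F) ⊕ (F^* ⊗ L) : f mod F = p(φ)}` of a symmetric principal
part `p ∈ Prin(L^{-1} ⊗ Sym² F)`. -/
noncomputable abbrev sympSheaf (p : Prin (symSheaf F L)) : C.Modules := extSheaf (symPrin p)

/-- The standard form `⟨f₂, φ₁⟩ - ⟨f₁, φ₂⟩ ∈ Rat(L)(U)` of two sections `(f₁, φ₁)`, `(f₂, φ₂)`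
of `W_p` over `U`. -/
noncomputable def stdForm {p : Prin (symSheaf F L)} {U : C.Opens}
    (v w : Γ(sympSheaf p, U)) : RatSec L U := fun h =>
  stalkEv (genericPoint C) ((twistedDual F L).presheaf.germ U _ h.down (extSnd v)) (extFst w h) -
  stalkEv (genericPoint C) ((twistedDual F L).presheaf.germ U _ h.down (extSnd w)) (extFst v h)

/-- The regular form `ω` on `W_p` is the restriction of the standard form. -/
def IsStandardForm {p : Prin (symSheaf F L)} (ω : sympSheaf p ⟶ homSheaf (sympSheaf p) L) :
    Prop :=
  ∀ (U : C.Opens) (v w : Γ(sympSheaf p, U)),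
    (show RatSec L U from (toRat L).app U (pairing ω v w)) = stdForm v w

end Standard

end SympExt

namespace SympExt

universe u

/-! ### Exactness of sequences of sheaves, connecting maps and functoriality of H¹ -/

section Exactness

variable {C : Scheme.{u}}

/-! Pairing with F gives a projection W → ℋom(F, L) = F^* ⊗ L, w ↦ ω(w, ·) (`dualProj`). Isotropy
puts F in its kernel. Since ω is nondegenerate and F is locally a direct summand, the projection
splits locally, and the count 2n = n + n forces the kernel to be exactly F
(`eq_of_dualProj_eq_zero`). A local splitting σ becomes isotropic after correcting it by one half of
the form ω(σ·, σ·), read as a map F^* ⊗ L → F through biduality (`exists_isLagrangianSection`). Two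
isotropic splittings differ by a symmetric map F^* ⊗ L → F
(`IsLagrangianSequence.exists_difference`).

For (a), fix an isotropic splitting σ₀ near the generic point and isotropic splittings σ_x near
every point x. The differences σ_x - σ₀ are rational sections of L⁻¹ ⊗ Sym² F, and because σ_x - σ_y
is regular their classes form a principal part p. Generically w = f + σ₀(φ), with φ the projection
of w. At x the section f - (σ_x - σ₀)(φ) = w - σ_x(φ) is regular, that is, f = p(φ) modulo F. So w ↦
(f, φ) maps W to W_p; it is the identity on F and on F^* ⊗ L, hence an isomorphism. As F and the
image of σ₀ are both isotropic, only the cross terms of ω survive, and these are the standard form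
(`toRat_pairing`).

For (b), p is locally one rational homomorphism β, and φ ↦ (β(φ), φ) splits W_p → F^* ⊗ L locally;
this gives exactness before and after applying ℋom(F^* ⊗ L, -). To compare classes, put M = L⁻¹ ⊗
Sym² F and consider the extension of 𝒪 by M formed by the pairs (r, u) with r = u p modulo M. It
maps to the sequence of principal parts with 1 ↦ p, and to the ℋom sequence with 1 ↦ id. Naturality
of the connecting map at 1 ∈ H⁰(𝒪) identifies the extension class with the image of [p]
(`H1map_prinClass`). No other class has this image, because symmetrization, available since 2 is
invertible, is a retraction of M → L⁻¹ ⊗ F ⊗ F. -/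

instance : (toAb C).Faithful where
  map_injective {M N} f g h := Scheme.Modules.hom_ext _ _ fun U => by
    ext s
    exact congr(($h).hom.app (op U) s)

lemma epi_of_locallySurjective {F G : AbSheaf C} (φ : F ⟶ G)
    (h : ∀ (U : C.Opens) (t : G.obj.obj (op U)) (x : C), x ∈ U → ∃ (V : C.Opens) (hV : V ≤ U),
      x ∈ V ∧ ∃ s : F.obj.obj (op V), φ.hom.app (op V) s = G.obj.map (homOfLE hV).op t) :
    Epi φ := by
  refine (TopCat.Sheaf.isLocallySurjective_iff_epi (X := C.toTopCat) φ).1 ?_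
  rw [TopCat.Presheaf.isLocallySurjective_iff]
  intro U t x hx
  obtain ⟨V, hV, hxV, s, hs⟩ := h U t x hx
  exact ⟨V, hV, ⟨s, hs⟩, hxV⟩

/-- A sequence of sheaves of abelian groups that is left exact on sections and locally surjective
on the right is short exact. -/
lemma shortExact_abSheaf {S : ShortComplex (AbSheaf C)}
    (inj : ∀ U, Function.Injective (S.f.hom.app (op U)))
    (ex : ∀ (U : C.Opens) (s : S.X₂.obj.obj (op U)), S.g.hom.app (op U) s = 0 →
      ∃ r : S.X₁.obj.obj (op U), S.f.hom.app (op U) r = s)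
    (surj : ∀ (U : C.Opens) (t : S.X₃.obj.obj (op U)) (x : C), x ∈ U →
      ∃ (V : C.Opens) (hV : V ≤ U),
      x ∈ V ∧ ∃ s : S.X₂.obj.obj (op V), S.g.hom.app (op V) s = S.X₃.obj.map (homOfLE hV).op t) :
    S.ShortExact := by
  -- This is the universal property of the kernel. Preimages are chosen section by section;
  -- injectivity of `S.f` makes the choice unique, hence additive and compatible with restriction.
  have lift : ∀ {A : AbSheaf C} (k : A ⟶ S.X₂), k ≫ S.g = 0 → ∃ l : A ⟶ S.X₁, l ≫ S.f = k := by
    intro A k hk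
    have hk' : ∀ (U : C.Opens) (a : A.obj.obj (op U)), ∃ r : S.X₁.obj.obj (op U),
        S.f.hom.app (op U) r = k.hom.app (op U) a := fun U a =>
      ex U _ congr(($hk).hom.app (op U) a)
    choose r hr using hk'
    refine ⟨⟨{ app := fun U => AddCommGrpCat.ofHom (AddMonoidHom.mk' (r U.unop) fun a b =>
                inj _ (by rw [map_add, hr, hr, hr, map_add]))
               naturality := fun U V i => ?_ }⟩, ?_⟩
    · ext a
      refine inj V.unop ?_
      change S.f.hom.app V (r V.unop (A.obj.map i a)) =
        S.f.hom.app V (S.X₁.obj.map i (r U.unop a))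
      rw [NatTrans.naturality_apply, hr]
      erw [hr, NatTrans.naturality_apply]
    · refine Sheaf.hom_ext (NatTrans.ext (funext fun U => ?_))
      ext a
      exact hr _ a
  have hmono : Mono S.f := ⟨fun g h e => Sheaf.hom_ext (NatTrans.ext (funext fun U => by
    ext a
    exact inj U.unop congr(($e).hom.app U a)))⟩
  have hepi : Epi S.g := epi_of_locallySurjective _ surj
  refine { exact := ShortComplex.exact_of_f_is_kernel _ ?_, mono_f := hmono, epi_g := hepi }
  exact Limits.KernelFork.IsLimit.ofι _ _ (fun k hk => (lift k hk).choose)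
    (fun k hk => (lift k hk).choose_spec) fun k hk m hm => by
      rw [← cancel_mono S.f, hm, (lift k hk).choose_spec]

/-- A sequence of `𝒪`-modules that is left exact on sections and locally surjective on the right
is short exact. -/
lemma shortExact_modules {S : ShortComplex C.Modules}
    (inj : ∀ U, Function.Injective (S.f.app U))
    (ex : ∀ (U : C.Opens) (s : Γ(S.X₂, U)), S.g.app U s = 0 →
      ∃ r : Γ(S.X₁, U), S.f.app U r = s)
    (surj : ∀ (U : C.Opens) (t : Γ(S.X₃, U)) (x : C), x ∈ U → ∃ (V : C.Opens) (hV : V ≤ U),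
      x ∈ V ∧ ∃ s : Γ(S.X₂, V), S.g.app V s = res S.X₃ hV t) :
    S.ShortExact := by
  have lift : ∀ {A : C.Modules} (k : A ⟶ S.X₂), k ≫ S.g = 0 → ∃ l : A ⟶ S.X₁, l ≫ S.f = k := by
    intro A k hk
    have hk' : ∀ (U : C.Opens) (a : Γ(A, U)), ∃ r : Γ(S.X₁, U), S.f.app U r = k.app U a :=
      fun U a => ex U _ congr(($hk).app U a)
    choose r hr using hk'
    refine ⟨homMk (fun U =>
      { toFun := r U
        map_add' := fun a b => inj U (by rw [map_add, hr, hr, hr, map_add])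
        map_smul' := fun c a => inj U (by
          simp only [RingHom.id_apply, Scheme.Modules.Hom.app_smul, hr]) })
        (fun h s => inj _ ?_), ?_⟩
    · change S.f.app _ (r _ (res A h s)) = S.f.app _ (res _ h (r _ s))
      rw [app_res, hr, hr, app_res]
    · refine Scheme.Modules.hom_ext _ _ fun U => ?_
      ext a
      exact hr U a
  have hmono : Mono S.f := ⟨fun g h e => Scheme.Modules.hom_ext _ _ fun U => by
    ext a
    exact inj U congr(($e).app U a)⟩
  -- A faithful functor reflects epimorphisms, so surjectivity may be tested on the underlying
  -- abelian sheaves.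
  have hepi : Epi S.g := (toAb C).epi_of_epi_map (epi_of_locallySurjective _ surj)
  refine { exact := ShortComplex.exact_of_f_is_kernel _ ?_, mono_f := hmono, epi_g := hepi }
  exact Limits.KernelFork.IsLimit.ofι _ _ (fun k hk => (lift k hk).choose)
    (fun k hk => (lift k hk).choose_spec) fun k hk m hm => by
      rw [← cancel_mono S.f, hm, (lift k hk).choose_spec]

/-- The connecting map is natural in the short exact sequence. -/
lemma map_connecting {S T : ShortComplex (AbSheaf C)} (hS : S.ShortExact) (hT : T.ShortExact)
    (φ : S ⟶ T) (s : S.X₃.obj.obj (op (⊤ : C.Opens))) :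
    Sheaf.H.map φ.τ₁ 1 (connecting hS s) = connecting hT (φ.τ₃.hom.app (op ⊤) s) := by
  -- The connecting map is Yoneda composition with `extClass`, so associativity reduces the claim to
  -- naturality of the extension class.
  rw [connecting, connecting, ← Sheaf.H.equiv₀_symm_naturality, Sheaf.H.map_apply,
    Sheaf.H.map_apply, Abelian.Ext.comp_assoc_of_third_deg_zero,
    ShortComplex.ShortExact.extClass_naturality hS hT φ,
    ← Abelian.Ext.comp_assoc _ _ _ (add_zero 0) (zero_add 1) (by simp)]

lemma H1map_comp {M N K : C.Modules} (f : M ⟶ N) (g : N ⟶ K) (c : H1 M) :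
    H1map g (H1map f c) = H1map (f ≫ g) c := by
  rw [H1map, H1map, H1map, Functor.map_comp, Sheaf.H.map_comp_apply]

lemma H1map_id (M : C.Modules) (c : H1 M) : H1map (𝟙 M) c = c := by
  rw [H1map, CategoryTheory.Functor.map_id, Sheaf.H.map_id_apply]

/-- A split monomorphism of `𝒪`-modules is injective on `H¹`. -/
lemma H1map_injective_of_retraction {M N : C.Modules} (f : M ⟶ N) (r : N ⟶ M) (h : f ≫ r = 𝟙 M) :
    Function.Injective (H1map f) :=
  Function.LeftInverse.injective (g := H1map r) fun c => by rw [H1map_comp, h, H1map_id]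

end Exactness

/-! ### Local homomorphisms as sections of ℋom -/

section HomSections

variable {C : Scheme.{u}} {M N K : C.Modules}

/-- A section of `ℋom(M, N)` from a compatible family of linear maps. -/
noncomputable def mkHom {U : C.Opens}
    (φ : ∀ V : C.Opens, V ≤ U → (Γ(M, V) →ₗ[Γ(C, V)] Γ(N, V)))
    (hφ : ∀ {V W : C.Opens} (hV : V ≤ U) (h : W ≤ V) (m : Γ(M, V)),
      res N h (φ V hV m) = φ W (h.trans hV) (res M h m)) : Γ(homSheaf M N, U) :=
  (show homSec M N U from ⟨fun V => φ V.1 V.2, fun V _ h m => hφ V.2 h m⟩)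

lemma hom_ext_ev {U : C.Opens} {φ ψ : Γ(homSheaf M N, U)}
    (h : ∀ (V : C.Opens) (hV : V ≤ U) (m : Γ(M, V)), ev φ hV m = ev ψ hV m) : φ = ψ :=
  homSec_ext (φ := φ) (ψ := ψ) h

lemma ev_zero {U V : C.Opens} (h : V ≤ U) (m : Γ(M, V)) :
    ev (0 : Γ(homSheaf M N, U)) h m = 0 := rfl

lemma ev_sub {U V : C.Opens} (φ ψ : Γ(homSheaf M N, U)) (h : V ≤ U) (m : Γ(M, V)) :
    ev (φ - ψ) h m = ev φ h m - ev ψ h m := rfl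

/-- Composition of local homomorphisms. -/
noncomputable def homComp {U : C.Opens} (ψ : Γ(homSheaf N K, U)) (φ : Γ(homSheaf M N, U)) :
    Γ(homSheaf M K, U) :=
  mkHom (fun _ h => (ev ψ h).comp (ev φ h)) fun hV h m => by
    simp only [LinearMap.comp_apply, res_ev]

lemma ev_homComp {U V : C.Opens} (ψ : Γ(homSheaf N K, U)) (φ : Γ(homSheaf M N, U)) (h : V ≤ U)
    (m : Γ(M, V)) : ev (homComp ψ φ) h m = ev ψ h (ev φ h m) := rfl

/-- The section of `ℋom(M, N)` over `U` given by a morphism `M ⟶ N`. -/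
noncomputable def homOn (f : M ⟶ N) (U : C.Opens) : Γ(homSheaf M N, U) :=
  mkHom (fun V _ => appLin f V) fun _ h m => (app_res f h m).symm

lemma ev_homOn (f : M ⟶ N) {U V : C.Opens} (h : V ≤ U) (m : Γ(M, V)) :
    ev (homOn f U) h m = f.app V m := rfl

lemma ev_res_self {U V : C.Opens} (φ : Γ(homSheaf M N, U)) (h : V ≤ U) (m : Γ(M, V)) :
    ev (res _ h φ) le_rfl m = ev φ h m := rfl

end HomSections

/-! ### Local frames and biduality -/

section Frames

variable {C : Scheme.{u}} {M N L F : C.Modules} {U : C.Opens} {ι : Type}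

/-- The basis of `M(V)` given by a local frame. -/
noncomputable def IsFrame.basis {e : ι → Γ(M, U)} (he : IsFrame M e) {V : C.Opens} (h : V ≤ U) :
    Module.Basis ι Γ(C, V) Γ(M, V) :=
  Module.Basis.mk (he V h).1 (he V h).2.ge

lemma IsFrame.basis_apply {e : ι → Γ(M, U)} (he : IsFrame M e) {V : C.Opens} (h : V ≤ U) (i : ι) :
    he.basis h i = res M h (e i) := Module.Basis.mk_apply _ _ i

lemma IsFrame.restrict {e : ι → Γ(M, U)} (he : IsFrame M e) {V : C.Opens} (h : V ≤ U) :
    IsFrame M fun i => res M h (e i) := fun W k => by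
  simp only [res_res]
  exact he W (k.trans h)

/-- The homomorphism with prescribed values on a frame. -/
noncomputable def IsFrame.hom {e : ι → Γ(M, U)} (he : IsFrame M e) (n : ι → Γ(N, U)) :
    Γ(homSheaf M N, U) :=
  mkHom (fun _ h => (he.basis h).constr ℕ fun i => res N h (n i)) fun {V W} hV h m => by
    -- Restriction is only semilinear, from 𝒪(V) to 𝒪(W), so the two sides are compared by induction
    -- on the span of the frame instead of by extensionality of linear maps.
    have hm : m ∈ Submodule.span Γ(C, V) (Set.range (he.basis hV)) := by
      rw [(he.basis hV).span_eq]; trivial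
    induction hm using Submodule.span_induction with
    | mem m hm =>
      obtain ⟨i, rfl⟩ := hm
      rw [Module.Basis.constr_basis, he.basis_apply, res_res, res_res, ← he.basis_apply,
        Module.Basis.constr_basis]
    | zero => simp
    | add a b _ _ ha hb => simp only [map_add, ha, hb]
    | smul c a _ ha => simp only [map_smul, res_smul, ha]

lemma IsFrame.ev_hom {e : ι → Γ(M, U)} (he : IsFrame M e) (n : ι → Γ(N, U)) {V : C.Opens}
    (h : V ≤ U) (i : ι) : ev (he.hom n) h (res M h (e i)) = res N h (n i) := by
  rw [← he.basis_apply h]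
  exact Module.Basis.constr_basis _ _ _ _

lemma IsFrame.ev_hom_self {e : ι → Γ(M, U)} (he : IsFrame M e) (n : ι → Γ(N, U)) (i : ι) :
    ev (he.hom n) le_rfl (e i) = n i := by
  simpa only [res_id] using he.ev_hom n le_rfl i

lemma IsFrame.hom_ext {e : ι → Γ(M, U)} (he : IsFrame M e) {φ ψ : Γ(homSheaf M N, U)}
    (h : ∀ i, ev φ le_rfl (e i) = ev ψ le_rfl (e i)) : φ = ψ := by
  refine hom_ext_ev fun V hV m => ?_
  refine LinearMap.congr_fun ((he.basis hV).ext fun i => ?_) m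
  rw [he.basis_apply, ← res_ev φ le_rfl hV, ← res_ev ψ le_rfl hV, h]

/-- Homomorphisms out of a framed module are families of sections. -/
noncomputable def IsFrame.homEquiv {e : ι → Γ(M, U)} (he : IsFrame M e) :
    Γ(homSheaf M N, U) ≃ₗ[Γ(C, U)] (ι → Γ(N, U)) where
  toFun φ i := ev φ le_rfl (e i)
  map_add' _ _ := rfl
  map_smul' r φ := funext fun i => by
    rw [ev_smul, fres_id]; rfl
  invFun n := he.hom n
  left_inv φ := he.hom_ext fun i => he.ev_hom_self _ i
  right_inv n := funext fun i => he.ev_hom_self n i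

lemma IsFrame.exists_coord {l : Fin 1 → Γ(L, U)} (hl : IsFrame L l) (s : Γ(L, U)) :
    ∃ r : Γ(C, U), s = r • l 0 := by
  refine ⟨(hl.basis le_rfl).repr s 0, ?_⟩
  conv_lhs => rw [← (hl.basis le_rfl).sum_repr s]
  rw [Fin.sum_univ_one, hl.basis_apply, res_id]

lemma IsFrame.smul_cancel {l : Fin 1 → Γ(L, U)} (hl : IsFrame L l) {r s : Γ(C, U)}
    (h : r • l 0 = s • l 0) : r = s := by
  have e : (hl.basis le_rfl) 0 = l 0 := by rw [hl.basis_apply, res_id]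
  rw [← e] at h
  simpa using congr((hl.basis le_rfl).repr $h 0)

/-- `F → ℋom(ℋom(F, L), L)` is bijective on sections. -/
def Reflexive (F L : C.Modules) : Prop :=
  ∀ (U : C.Opens) (θ : Γ(homSheaf (homSheaf F L) L, U)), ∃! f : Γ(F, U),
    ∀ (V : C.Opens) (h : V ≤ U) (b : Γ(homSheaf F L, V)),
      ev θ h b = ev b le_rfl (res F h f)

/-- The dual frame ε, with ε_i(e_k) = δ_ik l, spans ℋom(F, L) over each V. If θ(ε_k) = c_k l, then Σ
c_k e_k represents θ, and testing on the ε_i shows that no other section does. -/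
lemma IsFrame.reflexive [Fintype ι] {e : ι → Γ(F, U)} (he : IsFrame F e)
    {l : Fin 1 → Γ(L, U)} (hl : IsFrame L l) (θ : Γ(homSheaf (homSheaf F L) L, U)) :
    ∃! f : Γ(F, U), ∀ (V : C.Opens) (h : V ≤ U) (b : Γ(homSheaf F L, V)),
      ev θ h b = ev b le_rfl (res F h f) := by
  classical
  let ε : ι → Γ(homSheaf F L, U) := fun i => he.hom fun k => if k = i then l 0 else 0
  have hε : ∀ (V : C.Opens) (h : V ≤ U) (i k : ι),
      ev (ε i) h (res F h (e k)) = if k = i then res L h (l 0) else 0 := fun V h i k => by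
    rw [he.ev_hom]; split_ifs <;> simp
  have expand : ∀ f : Γ(F, U), f = ∑ k, (he.basis le_rfl).repr f k • e k := fun f => by
    conv_lhs => rw [← (he.basis le_rfl).sum_repr f]
    simp only [he.basis_apply, res_id]
  choose c hc using fun k => hl.exists_coord (ev θ le_rfl (ε k))
  refine ⟨∑ k, c k • e k, fun V h b => ?_, fun f hf => ?_⟩
  · choose d hd using fun k => (hl.restrict h).exists_coord (ev b le_rfl (res F h (e k)))
    have hb : b = ∑ k, d k • res _ h (ε k) := by
      refine (he.restrict h).hom_ext fun i => ?_
      rw [hd]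
      have : ∀ s : Finset ι, ev (∑ k ∈ s, d k • res _ h (ε k)) le_rfl (res F h (e i)) =
          ∑ k ∈ s, d k • ev (ε k) h (res F h (e i)) := by
        intro s
        induction s using Finset.induction_on with
        | empty => rfl
        | insert a s ha ih =>
          rw [Finset.sum_insert ha, Finset.sum_insert ha, ev_add, ih, ev_smul, fres_id, ev_res_self]
      rw [this]
      simp [hε]
    conv_lhs => rw [hb]
    simp only [map_sum, map_smul, res_smul, hd]
    refine Finset.sum_congr rfl fun k _ => ?_
    rw [← res_ev θ le_rfl h, hc, res_smul, smul_comm]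
  · rw [expand f]
    refine Finset.sum_congr rfl fun i _ => ?_
    congr 1
    refine hl.smul_cancel ?_
    rw [← hc, hf, res_id]
    conv_rhs => rw [expand f, map_sum]
    have := fun k => hε U le_rfl i k
    simp only [res_id] at this
    simp [this]

/-- Local representing sections exist by the framed case, and their uniqueness makes them agree on
overlaps. -/
lemma Reflexive.of_isVectorBundle {r : ℕ} (hF : IsVectorBundle F r) (hL : IsVectorBundle L 1) :
    Reflexive F L := by
  intro U θ
  -- Unique representability is recorded for every `W ≤ V`, because gluing needs it on the
  -- intersections `V x ⊓ V y`.
  have key : ∀ x : U, ∃ V : C.Opens, x.1 ∈ V ∧ ∃ h : V ≤ U, ∀ (W : C.Opens) (hW : W ≤ V),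
      ∃! f : Γ(F, W), ∀ (T : C.Opens) (h' : T ≤ W) (b : Γ(homSheaf F L, T)),
        ev θ (h'.trans (hW.trans h)) b = ev b le_rfl (res F h' f) := fun x => by
    obtain ⟨V, e, hx, he⟩ := hF x.1
    obtain ⟨V', l, hx', hl⟩ := hL x.1
    refine ⟨U ⊓ V ⊓ V', ⟨⟨x.2, hx⟩, hx'⟩, inf_le_left.trans inf_le_left, fun W hW => ?_⟩
    exact (he.restrict (hW.trans (inf_le_left.trans inf_le_right))).reflexive
      (hl.restrict (hW.trans inf_le_right)) (res _ (hW.trans (inf_le_left.trans inf_le_left)) θ)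
  choose V hxV hVU hV using key
  have cov : U ≤ iSup V := fun x hx => Opens.mem_iSup.2 ⟨⟨x, hx⟩, hxV ⟨x, hx⟩⟩
  choose f hf hfu using fun x => hV x (V x) le_rfl
  obtain ⟨g, hg⟩ := glue F V hVU cov f fun x y => by
    refine (hV x (V x ⊓ V y) inf_le_left).unique (fun T h b => ?_) (fun T h b => ?_)
    · rw [res_res]; exact hf x T _ b
    · rw [res_res]; exact hf y T _ b
  refine ⟨g, fun T hT b => ?_, fun g' hg' => ?_⟩
  · refine sep L (fun x => T ⊓ V x) (fun x => inf_le_left) ?_ _ _ fun x => ?_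
    · rw [← inf_iSup_eq]; exact le_inf le_rfl (hT.trans cov)
    · rw [res_ev, res_ev, hf x _ inf_le_right, ← hg x, res_res, res_res]
      rfl
  · refine sep F V hVU cov _ _ fun x => ?_
    refine (hV x (V x) le_rfl).unique (fun T h b => ?_) (fun T h b => ?_)
    · rw [res_res]; exact hg' T _ b
    · rw [hg]; exact hf x T h b

end Frames

/-! ### Sections of F determined by, and built from, functionals on ℋom(F, L) -/

section Bidual

variable {C : Scheme.{u}} {F L : C.Modules} (h : Reflexive F L)

namespace Reflexive

/-- Both sections represent the functional b ↦ b(g), and the representing section is unique. -/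
lemma eq_of_forall (h : Reflexive F L) {U : C.Opens} {f g : Γ(F, U)}
    (hfg : ∀ (V : C.Opens) (k : V ≤ U) (b : Γ(homSheaf F L, V)),
      ev b le_rfl (res F k f) = ev b le_rfl (res F k g)) : f = g := by
  let θ : Γ(homSheaf (homSheaf F L) L, U) := mkHom (fun V k =>
    { toFun := fun b => ev b le_rfl (res F k g)
      map_add' := fun _ _ => rfl
      map_smul' := fun r b => by rw [ev_smul, fres_id]; rfl }) fun {V W} hV k b => by
        change res L k (ev b le_rfl _) = ev (res _ k b) le_rfl _
        rw [res_ev, res_res]; rfl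
  exact (h U θ).unique (fun V k b => (hfg V k b).symm) fun V k b => rfl

/-- The section of `F` represented by a functional on `ℋom(F, L)`. -/
noncomputable def repr {U : C.Opens} (θ : Γ(homSheaf (homSheaf F L) L, U)) : Γ(F, U) :=
  (h U θ).choose

lemma ev_repr {U V : C.Opens} (θ : Γ(homSheaf (homSheaf F L) L, U)) (k : V ≤ U)
    (b : Γ(homSheaf F L, V)) : ev b le_rfl (res F k (h.repr θ)) = ev θ k b :=
  ((h U θ).choose_spec.1 V k b).symm

end Reflexive

end Bidual

/-! ### Torsion-free sheaves: sections are determined at the generic point -/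

section TorsionFree

variable {C : Scheme.{u}} [IrreducibleSpace C] {M N F L : C.Modules}

/-- Sections over an empty open set are equal. -/
lemma eq_of_generic_notMem {U : C.Opens} (h : genericPoint C ∉ U) (s t : Γ(M, U)) : s = t :=
  sep M (fun i : PEmpty => i.elim) (fun i => i.elim) (fun _ hx => (h (generic_mem hx)).elim) s t
    fun i => i.elim

/-- Restriction to nonempty open subsets is injective. -/
def TorsionFree (M : C.Modules) : Prop :=
  ∀ {U V : C.Opens} (h : V ≤ U), genericPoint C ∈ V → ∀ s : Γ(M, U), res M h s = 0 → s = 0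

lemma TorsionFree.eq_zero (hM : TorsionFree M) {U : C.Opens} {s : Γ(M, U)}
    (h : ∀ hU : genericPoint C ∈ U, M.presheaf.germ U _ hU s = 0) : s = 0 := by
  by_cases hU : genericPoint C ∈ U
  · obtain ⟨V, hV, i, j, e⟩ := TopCat.Presheaf.germ_eq M.presheaf _ hU hU s 0
      ((h hU).trans (map_zero _).symm)
    exact hM i.le hV s (Eq.trans e (map_zero _))
  · exact eq_of_generic_notMem hU _ _

lemma TorsionFree.eq_of_germ (hM : TorsionFree M) {U : C.Opens} {s t : Γ(M, U)}
    (h : ∀ hU : genericPoint C ∈ U, M.presheaf.germ U _ hU s = M.presheaf.germ U _ hU t) :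
    s = t :=
  sub_eq_zero.1 <| hM.eq_zero fun hU => by rw [map_sub, h hU, sub_self]

/-- The value of φ on a section over W restricts to zero on W ∩ V, which still contains the generic
point when W does. -/
lemma TorsionFree.homSheaf (hN : TorsionFree N) : TorsionFree (homSheaf M N) := by
  intro U V h hV φ hφ
  refine hom_ext_ev fun W hW m => ?_
  rw [ev_zero]
  by_cases hη : genericPoint C ∈ W
  · refine hN (inf_le_left : W ⊓ V ≤ W) ⟨hη, hV⟩ _ ?_
    rw [res_ev, ← ev_res φ h inf_le_right, hφ, ev_zero]
  · exact eq_of_generic_notMem hη _ _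

lemma TorsionFree.symSheaf (hF : TorsionFree F) : TorsionFree (symSheaf F L) := by
  intro U V h hV φ hφ
  exact Subtype.ext (hF.homSheaf h hV φ.1 congr(($hφ).1))

/-- In a local frame the claim concerns coordinates, and on an integral scheme restriction of
functions to a nonempty open subset is injective. -/
lemma TorsionFree.of_isVectorBundle [IsIntegral C] {r : ℕ} (hM : IsVectorBundle M r) :
    TorsionFree M := by
  intro U V h hV s hs
  choose T e hx he using hM
  refine sep M (fun x : C => U ⊓ T x) (fun x => inf_le_left) ?_ _ _ fun x => ?_
  · rw [← inf_iSup_eq]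
    exact le_inf le_rfl fun x _ => Opens.mem_iSup.2 ⟨x, hx x⟩
  rw [map_zero]
  by_cases hη : genericPoint C ∈ U ⊓ T x
  swap
  · exact eq_of_generic_notMem hη _ _
  let b := (he x).basis (inf_le_right : U ⊓ T x ≤ T x)
  let b' := (he x).basis (inf_le_right.trans inf_le_right : V ⊓ (U ⊓ T x) ≤ T x)
  have e1 : res M (inf_le_right : V ⊓ (U ⊓ T x) ≤ U ⊓ T x) (res M inf_le_left s) = 0 := by
    rw [res_res, ← res_res M h inf_le_left, hs, map_zero]
  rw [← b.sum_repr (res M inf_le_left s)] at e1 ⊢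
  refine Finset.sum_eq_zero fun i _ => ?_
  have e2 : ∑ i, fres (inf_le_right : V ⊓ (U ⊓ T x) ≤ U ⊓ T x)
      (b.repr (res M inf_le_left s) i) • b' i = 0 := by
    rw [← e1, map_sum]
    refine Finset.sum_congr rfl fun i _ => ?_
    rw [res_smul, (he x).basis_apply, (he x).basis_apply, res_res]
  have e3 := Fintype.linearIndependent_iff.1 b'.linearIndependent _ e2 i
  have : Nonempty (V ⊓ (U ⊓ T x) : C.Opens) := ⟨⟨_, hV, hη⟩⟩
  have e4 : b.repr (res M inf_le_left s) i = 0 :=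
    map_injective_of_isIntegral C (homOfLE (inf_le_right : V ⊓ (U ⊓ T x) ≤ U ⊓ T x))
      (e3.trans (map_zero _).symm)
  rw [e4, zero_smul]

end TorsionFree

/-! ### Rational sections, regularity at a point, and the sequence of principal parts -/

section Stalks

variable {C : Scheme.{u}} {M N : C.Modules}

lemma stalkEv_smul_left (x : C) {U : C.Opens} (hU : x ∈ U) (r : Γ(C, U))
    (s : (homSheaf M N).presheaf.stalk x) (m : M.presheaf.stalk x) :
    stalkEv x (C.presheaf.germ U x hU r • s) m = C.presheaf.germ U x hU r • stalkEv x s m := by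
  obtain ⟨V, hV, kφ⟩ := exists_germ _ x s
  obtain ⟨V', hV', ka⟩ := exists_germ _ x m
  have hW : x ∈ U ⊓ V ⊓ V' := ⟨⟨hU, hV⟩, hV'⟩
  obtain ⟨φ, rfl⟩ := kφ (U ⊓ V ⊓ V') hW (inf_le_left.trans inf_le_right)
  obtain ⟨a, rfl⟩ := ka (U ⊓ V ⊓ V') hW inf_le_right
  rw [← germ_fres (inf_le_left.trans inf_le_left : U ⊓ V ⊓ V' ≤ U) x hW, ← germ_smul,
    stalkEv_germ, stalkEv_germ, ev_smul, fres_id, germ_smul]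

/-- Evaluation of germs of sections defined on different neighbourhoods. -/
lemma stalkEv_germ_of_le (x : C) {U V : C.Opens} (h : V ≤ U) (hV : x ∈ V)
    (φ : Γ(homSheaf M N, U)) (a : Γ(M, V)) :
    stalkEv x ((homSheaf M N).presheaf.germ U x (h hV) φ) (M.presheaf.germ V x hV a) =
      N.presheaf.germ V x hV (ev φ h a) := by
  rw [← germ_res _ h x hV, stalkEv_germ, ev_res_self]

variable [IrreducibleSpace C]

lemma ratStalkMap_smul (f : M ⟶ N) {U : C.Opens} (hU : genericPoint C ∈ U) (r : Γ(C, U))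
    (m : RatStalk M) :
    ratStalkMap f (C.presheaf.germ U _ hU r • m) = C.presheaf.germ U _ hU r • ratStalkMap f m := by
  obtain ⟨V, hV, ka⟩ := exists_germ _ _ m
  have hW : genericPoint C ∈ U ⊓ V := ⟨hU, hV⟩
  obtain ⟨a, rfl⟩ := ka (U ⊓ V) hW inf_le_right
  rw [← germ_fres (inf_le_left : U ⊓ V ≤ U) _ hW, ← germ_smul, ratStalkMap_germ,
    ratStalkMap_germ, Scheme.Modules.Hom.app_smul, germ_smul]

lemma exists_of_mem_regAt {x : C} {m : RatStalk M} (hm : m ∈ regAt M x) :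
    ∃ U : C.Opens, x ∈ U ∧ ∀ (V : C.Opens) (hV : x ∈ V), V ≤ U →
      ∃ a : Γ(M, V), M.presheaf.germ V _ (generic_mem hV) a = m := by
  obtain ⟨s, rfl⟩ := hm
  obtain ⟨U, hU, k⟩ := exists_germ M x s
  refine ⟨U, hU, fun V hV h => ?_⟩
  obtain ⟨a, rfl⟩ := k V hV h
  exact ⟨a, (spec_germ M x hV a).symm⟩

lemma germ_mem_regAt {x : C} {U : C.Opens} (hx : x ∈ U) (h : genericPoint C ∈ U) (m : Γ(M, U)) :
    M.presheaf.germ U _ h m ∈ regAt M x :=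
  ⟨M.presheaf.germ U x hx m, spec_germ M x hx m⟩

/-- A rational section that is regular at every point of `U` comes from a section over `U`. -/
lemma TorsionFree.exists_section (hM : TorsionFree M) {U : C.Opens} (s : RatSec M U)
    (hs : ∀ (x : C) (hx : x ∈ U), s ⟨generic_mem hx⟩ ∈ regAt M x) :
    ∃ m : Γ(M, U), ∀ h : genericPoint C ∈ U, M.presheaf.germ U _ h m = s ⟨h⟩ := by
  have key : ∀ x : U, ∃ V : C.Opens, x.1 ∈ V ∧ ∃ (_ : V ≤ U) (a : Γ(M, V)),
      ∀ h, M.presheaf.germ V _ h a = s ⟨generic_mem x.2⟩ := fun x => by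
    obtain ⟨V, hV, k⟩ := exists_of_mem_regAt (hs x.1 x.2)
    obtain ⟨a, ha⟩ := k (U ⊓ V) ⟨x.2, hV⟩ inf_le_right
    exact ⟨U ⊓ V, ⟨x.2, hV⟩, inf_le_left, a, fun _ => ha⟩
  choose V hxV hVU a ha using key
  obtain ⟨m, hm⟩ := glue M V hVU (fun x hx => Opens.mem_iSup.2 ⟨⟨x, hx⟩, hxV ⟨x, hx⟩⟩) a
    fun x y => hM.eq_of_germ fun h => by
      rw [germ_res, germ_res, ha, ha]
  refine ⟨m, fun h => ?_⟩
  rw [← germ_res M (hVU ⟨_, h⟩) _ (hxV ⟨_, h⟩), hm, ha]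

lemma TorsionFree.toRat_injective (hM : TorsionFree M) (U : C.Opens) :
    Function.Injective ((toRat M).app U) := fun _ _ h =>
  hM.eq_of_germ fun hU => congr_fun (f := (_ : RatSec M U)) h ⟨hU⟩

/-- The sequence `0 → M → Rat(M) → Prin(M) → 0` is exact. -/
lemma TorsionFree.prinSeq_shortExact (hM : TorsionFree M) : (prinSeq M).ShortExact := by
  refine shortExact_abSheaf (S := prinSeq M) (fun U => hM.toRat_injective U) (fun U s hs => ?_)
    fun U t x hx => ?_
  · obtain ⟨m, hm⟩ := hM.exists_section (U := U) s fun x hx =>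
      (QuotientAddGroup.eq_zero_iff _).1 congr(($hs).1 ⟨x, hx⟩)
    exact ⟨m, funext fun h => hm h.down⟩
  · obtain ⟨V, hV, β, hxV, h⟩ := t.2 ⟨x, hx⟩
    exact ⟨V, hV, hxV, fun _ => β, Subtype.ext (funext fun y => (h y.1 y.2).symm)⟩

end Stalks

/-! ### Exactness of ℋom(S₃, -) -/

section HomSequence

variable {C : Scheme.{u}}

/-- `ℋom(S₃, -)` is left exact; the resulting sequence is exact if local homomorphisms to `S₃`
lift locally. -/
lemma homSeq_shortExact {S : ShortComplex C.Modules}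
    (inj : ∀ U, Function.Injective (S.f.app U))
    (ex : ∀ (U : C.Opens) (s : Γ(S.X₂, U)), S.g.app U s = 0 → ∃ r : Γ(S.X₁, U), S.f.app U r = s)
    (surj : ∀ (U : C.Opens) (t : Γ(homSheaf S.X₃ S.X₃, U)) (x : C), x ∈ U →
      ∃ (V : C.Opens) (hV : V ≤ U), x ∈ V ∧ ∃ s : Γ(homSheaf S.X₃ S.X₂, V),
        (homSheafMap S.X₃ S.g).app V s = res _ hV t) :
    (homSeq S).ShortExact := by
  refine shortExact_abSheaf (S := homSeq S) (fun U φ ψ h => ?_) (fun U s hs => ?_) surj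
  · exact hom_ext_ev (φ := φ) (ψ := ψ) fun V hV m => inj V congr(ev $h hV m)
  · have k : ∀ (V : C.Opens) (hV : V ≤ U) (m : Γ(S.X₃, V)), ∃ r : Γ(S.X₁, V),
        S.f.app V r = ev (N := S.X₂) s hV m := fun V hV m => ex V _ congr(ev $hs hV m)
    choose r hr using k
    refine ⟨mkHom (fun V hV =>
      { toFun := r V hV
        map_add' := fun a b => inj V (by rw [map_add, hr, hr, hr, map_add])
        map_smul' := fun c a => inj V (by
          rw [RingHom.id_apply, Scheme.Modules.Hom.app_smul, hr, hr, map_smul]) })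
      fun {V W} hV h m => inj W ?_, hom_ext_ev fun V hV m => hr V hV m⟩
    change S.f.app W (res _ h (r V hV m)) = S.f.app W (r W _ (res _ h m))
    rw [app_res, hr, hr]
    exact res_ev (N := S.X₂) s hV h m

end HomSequence

/-! ### Exactness of 0 → F → W_q → G → 0 and of its ℋom sequence -/

section ExtensionSequence

variable {C : Scheme.{u}} [IrreducibleSpace C] {G F : C.Modules} {q : Prin (homSheaf G F)}

lemma ext_section {U : C.Opens} {v w : Γ(extSheaf q, U)} (h₁ : extFst v = extFst w)
    (h₂ : extSnd v = extSnd w) : v = w :=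
  Subtype.ext (Prod.ext h₁ h₂)

/-- A section of `W_q` from its components. -/
noncomputable def extMk {U : C.Opens} (f : RatSec F U) (φ : Γ(G, U))
    (h : ∀ (x : C) (hx : x ∈ U), (QuotientAddGroup.mk (f ⟨generic_mem hx⟩) :
      RatStalk F ⧸ regAt F x) = prinEv x (q.1 ⟨x, trivial⟩) (G.presheaf.germ U x hx φ)) :
    Γ(extSheaf q, U) :=
  (show extSec q U from ⟨(f, φ), h⟩)

lemma extSheaf_condition {U : C.Opens} (w : Γ(extSheaf q, U)) (x : C) (hx : x ∈ U) :
    (QuotientAddGroup.mk (extFst w ⟨generic_mem hx⟩) : RatStalk F ⧸ regAt F x) =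
      prinEv x (q.1 ⟨x, trivial⟩) (G.presheaf.germ U x hx (extSnd w)) :=
  (show extSec q U from w).2 x hx

lemma prinEv_mk_germ (x : C) {U : C.Opens} (hx : x ∈ U) (s : RatStalk (homSheaf G F))
    (a : Γ(G, U)) : prinEv x (QuotientAddGroup.mk s) (G.presheaf.germ U x hx a) =
      QuotientAddGroup.mk (stalkEv _ s (G.presheaf.germ U _ (generic_mem hx) a)) := by
  rw [prinEv_mk, spec_germ]

variable (q) in
lemma extIncl_injective (hF : TorsionFree F) (U : C.Opens) :
    Function.Injective ((extIncl q).app U) := fun _ _ h =>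
  hF.eq_of_germ fun hU => congr(extFst $h ⟨hU⟩)

variable (q) in
-- For a section (f, 0) the defining condition says that f is regular at every point of U, so f
-- comes from a section of F.
lemma extSeq_exact_sections (hF : TorsionFree F) (U : C.Opens) (w : Γ(extSheaf q, U))
    (hw : (extProj q).app U w = 0) : ∃ f : Γ(F, U), (extIncl q).app U f = w := by
  have hw' : extSnd w = 0 := hw
  obtain ⟨f, hf⟩ := hF.exists_section (extFst w) fun x hx => by
    rw [← QuotientAddGroup.eq_zero_iff, extSheaf_condition _ x hx, hw', map_zero, map_zero]
  exact ⟨f, ext_section (funext fun h => hf h.down) hw'.symm⟩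

variable (q) in
-- Near a given point q is the class of a single rational homomorphism β, and there a section t of G
-- lifts to (β(t), t).
lemma extSeq_shortExact (hF : TorsionFree F) : (extSeq q).ShortExact := by
  refine shortExact_modules (S := extSeq q) (extIncl_injective q hF) (extSeq_exact_sections q hF)
    fun U t x hx => ?_
  obtain ⟨V, hV, β, hxV, h⟩ := q.2 ⟨x, trivial⟩
  refine ⟨U ⊓ V, inf_le_left, ⟨hx, hxV⟩, extMk
    (fun k => stalkEv _ β (G.presheaf.germ (U ⊓ V) _ k.down (res G inf_le_left t)))
    (res G inf_le_left t) fun y hy => ?_, rfl⟩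
  rw [h y hy.2, prinEv_mk_germ]

/-- The local homomorphism `G ⟶ W_q`, `a ↦ (r(s(a)), t(a))`, for a rational homomorphism
`r : G ⟶ F` and homomorphisms `s, t : G ⟶ G`. -/
noncomputable def extHom {U : C.Opens} (r : RatSec (homSheaf G F) U) (s t : Γ(homSheaf G G, U))
    (h : ∀ (V : C.Opens) (hV : V ≤ U) (a : Γ(G, V)) (x : C) (hx : x ∈ V),
      (QuotientAddGroup.mk (stalkEv _ (r ⟨hV (generic_mem hx)⟩)
        (G.presheaf.germ V _ (generic_mem hx) (ev s hV a))) : RatStalk F ⧸ regAt F x) =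
      prinEv x (q.1 ⟨x, trivial⟩) (G.presheaf.germ V x hx (ev t hV a))) :
    Γ(homSheaf G (extSheaf q), U) :=
  mkHom (fun V hV =>
    { toFun := fun a => extMk
        (fun k => stalkEv _ (r ⟨hV k.down⟩) (G.presheaf.germ V _ k.down (ev s hV a)))
        (ev t hV a) fun x hx => h V hV a x hx
      map_add' := fun a b => ext_section
        (funext fun k => by
          change stalkEv _ _ (G.presheaf.germ V _ k.down (ev s hV (a + b))) = _
          rw [map_add, map_add, map_add]; rfl) (map_add (ev t hV) a b)
      map_smul' := fun c a => ext_section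
        (funext fun k => by
          change stalkEv _ _ (G.presheaf.germ V _ k.down (ev s hV (c • a))) = _
          rw [map_smul, germ_smul, stalkEv_smul]; rfl) (map_smul (ev t hV) c a) })
    fun {V W} hV k m => ext_section
      (funext fun k' => by
        change stalkEv _ _ (G.presheaf.germ V _ (k k'.down) (ev s hV m)) =
          stalkEv _ _ (G.presheaf.germ W _ k'.down (ev s _ (res G k m)))
        rw [← res_ev s hV k, germ_res]) (res_ev t hV k m)

variable (q) in
-- The local lift t ↦ (β(t), t) is linear, so a local endomorphism t of G lifts as well, to a ↦
-- (β(t(a)), t(a)).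
lemma homSeq_extSeq_shortExact (hF : TorsionFree F) : (homSeq (extSeq q)).ShortExact := by
  refine homSeq_shortExact (S := extSeq q) (extIncl_injective q hF) (extSeq_exact_sections q hF)
    fun U t x hx => ?_
  obtain ⟨V, hV, β, hxV, h⟩ := q.2 ⟨x, trivial⟩
  refine ⟨U ⊓ V, inf_le_left, ⟨hx, hxV⟩, extHom (fun _ => β)
    (res (homSheaf G G) inf_le_left t) (res (homSheaf G G) inf_le_left t)
    fun W hW a y hy => ?_, hom_ext_ev fun W hW m => rfl⟩
  rw [h y (hW hy).2]
  exact (prinEv_mk_germ y hy β (ev (res (homSheaf G G) inf_le_left t) hW a)).symm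

end ExtensionSequence

/-! ### The extension of 𝒪 attached to a principal part, and comparison of connecting maps -/

section MultiplesOfPrincipalPart

variable {C : Scheme.{u}}

variable (C) in
/-- The sheaf of abelian groups underlying the structure sheaf. -/
noncomputable def structureAb : AbData C.toTopCat where
  sec U := Γ(C, U)
  res h := (fres h).toAddMonoidHom
  res_id := fres_id
  res_res := fres_fres
  sep U s t h := C.sheaf.eq_of_locally_eq U s t h
  glue U s h := (C.sheaf.existsUnique_gluing U s fun i j => h i j).exists

variable [IrreducibleSpace C] {M : C.Modules}

/-- Multiplication by a regular function on `M_η / M_x`. -/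
noncomputable def quotSmul (M : C.Modules) {U : C.Opens} {x : C} (hx : x ∈ U) (r : Γ(C, U)) :
    RatStalk M ⧸ regAt M x →+ RatStalk M ⧸ regAt M x :=
  QuotientAddGroup.map _ _
    (DistribSMul.toAddMonoidHom (RatStalk M) (C.presheaf.germ U _ (generic_mem hx) r))
    fun _ hm => smul_mem_regAt M x hx r hm

lemma quotSmul_mk {U : C.Opens} {x : C} (hx : x ∈ U) (r : Γ(C, U)) (m : RatStalk M) :
    quotSmul M hx r (QuotientAddGroup.mk m) =
      QuotientAddGroup.mk (C.presheaf.germ U _ (generic_mem hx) r • m) := rfl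

lemma quotSmul_add {U : C.Opens} {x : C} (hx : x ∈ U) (r s : Γ(C, U))
    (m : RatStalk M ⧸ regAt M x) :
    quotSmul M hx (r + s) m = quotSmul M hx r m + quotSmul M hx s m := by
  obtain ⟨m, rfl⟩ := QuotientAddGroup.mk_surjective m
  rw [quotSmul_mk, map_add, add_smul]; rfl

lemma quotSmul_fres {U V : C.Opens} (h : V ≤ U) {x : C} (hx : x ∈ V) (r : Γ(C, U))
    (m : RatStalk M ⧸ regAt M x) : quotSmul M hx (fres h r) m = quotSmul M (h hx) r m := by
  obtain ⟨m, rfl⟩ := QuotientAddGroup.mk_surjective m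
  rw [quotSmul_mk, quotSmul_mk, germ_fres]

lemma quotSmul_one {U : C.Opens} {x : C} (hx : x ∈ U) (m : RatStalk M ⧸ regAt M x) :
    quotSmul M hx 1 m = m := by
  obtain ⟨m, rfl⟩ := QuotientAddGroup.mk_surjective m
  rw [quotSmul_mk, map_one, one_smul]

variable (p : Prin M)

/-- The pairs `(r, u)` of a rational section and a regular function with `r = u p` modulo `M`. -/
noncomputable def mulSec (U : C.Opens) : AddSubgroup (RatSec M U × Γ(C, U)) where
  carrier := {w | ∀ (x : C) (hx : x ∈ U), (QuotientAddGroup.mk (w.1 ⟨generic_mem hx⟩) :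
    RatStalk M ⧸ regAt M x) = quotSmul M hx w.2 (p.1 ⟨x, trivial⟩)}
  zero_mem' x hx := by
    obtain ⟨m, hm⟩ := QuotientAddGroup.mk_surjective (p.1 ⟨x, trivial⟩)
    rw [← hm, quotSmul_mk]
    change QuotientAddGroup.mk (0 : RatStalk M) = QuotientAddGroup.mk (C.presheaf.germ U _ _ 0 • m)
    rw [map_zero, zero_smul]
  add_mem' {v w} hv hw x hx := by
    change _ = quotSmul M hx (v.2 + w.2) _
    rw [quotSmul_add, ← hv x hx, ← hw x hx]; rfl
  neg_mem' {w} hw x hx := by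
    have h := hw x hx
    obtain ⟨m, hm⟩ := QuotientAddGroup.mk_surjective (p.1 ⟨x, trivial⟩)
    rw [← hm, quotSmul_mk] at h ⊢
    change -(QuotientAddGroup.mk (w.1 _) : RatStalk M ⧸ regAt M x) =
      QuotientAddGroup.mk (C.presheaf.germ U _ _ (-w.2) • m)
    rw [map_neg, neg_smul, h]; rfl

/-- The sheaf of pairs `(r, u)` with `r = u p` modulo `M`. -/
noncomputable def mulAb : AbData C.toTopCat where
  sec U := mulSec p U
  res {U V} h :=
    { toFun := fun w => ⟨(ratRes M h w.1.1, fres h w.1.2), fun x hx => by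
        rw [quotSmul_fres]; exact w.2 x (h hx)⟩
      map_zero' := Subtype.ext (Prod.ext (map_zero (ratRes M h)) (map_zero (fres h)))
      map_add' := fun v w => Subtype.ext (Prod.ext (map_add (ratRes M h) v.1.1 w.1.1)
        (map_add (fres h) v.1.2 w.1.2)) }
  res_id w := Subtype.ext (Prod.ext rfl (fres_id w.1.2))
  res_res h k w := Subtype.ext (Prod.ext rfl (fres_fres h k w.1.2))
  sep U v w h := Subtype.ext <| Prod.ext
    ((ratMod M).sep U v.1.1 w.1.1 fun i => congr(($(h i)).1.1))
    ((structureAb C).sep U _ _ fun i => congr(($(h i)).1.2))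
  glue U w h := by
    obtain ⟨f, hf⟩ := (ratMod M).glue U (fun i => (w i).1.1) fun i j => congr(($(h i j)).1.1)
    obtain ⟨φ, hφ⟩ := (structureAb C).glue U (fun i => (w i).1.2)
      fun i j => congr(($(h i j)).1.2)
    refine ⟨⟨(f, φ), fun x hx => ?_⟩, fun i => Subtype.ext (Prod.ext (hf i) (hφ i))⟩
    obtain ⟨i, hi⟩ := Opens.mem_iSup.1 hx
    have e := (w i).2 x hi
    rw [← hf i, ← hφ i] at e
    exact e.trans (quotSmul_fres (le_iSup U i) hi φ _)

/-- The sequence `0 → M → {(r, u) : r = u p mod M} → 𝒪 → 0`. -/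
noncomputable def mulSeq : ShortComplex (AbSheaf C) where
  X₁ := (toAb C).obj M
  X₂ := (mulAb p).sheaf
  X₃ := (structureAb C).sheaf
  f := ⟨{ app := fun U => AddCommGrpCat.ofHom
            { toFun := fun m : Γ(M, U.unop) => (⟨(fun h => M.presheaf.germ U.unop _ h.down m, 0),
                fun x hx => by
                  obtain ⟨b, hb⟩ := QuotientAddGroup.mk_surjective (p.1 ⟨x, trivial⟩)
                  rw [← hb, quotSmul_mk, map_zero, zero_smul]
                  exact (QuotientAddGroup.eq_zero_iff _).2 (germ_mem_regAt hx _ m)⟩ :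
                mulSec p U.unop)
              map_zero' := Subtype.ext (Prod.ext (funext fun h => map_zero _) rfl)
              map_add' := fun a b => Subtype.ext (Prod.ext (funext fun h => map_add _ a b)
                (add_zero _).symm) }
          naturality := fun U V i => by
            ext m
            exact Subtype.ext (Prod.ext (funext fun h => germ_res M i.unop.le _ h.down m)
              (map_zero (fres i.unop.le)).symm) }⟩
  g := ⟨{ app := fun U => AddCommGrpCat.ofHom
            ((AddMonoidHom.snd (RatSec M U.unop) Γ(C, U.unop)).comp (mulSec p U.unop).subtype)
          naturality := fun _ _ _ => rfl }⟩
  zero := rfl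

/-- In a pair (r, 0) the rational section r is regular everywhere. Where p is the class of β, a
function u lifts to (uβ, u). -/
lemma mulSeq_shortExact (hM : TorsionFree M) : (mulSeq p).ShortExact := by
  refine shortExact_abSheaf (S := mulSeq p) (fun U s t h => ?_) (fun U w hw => ?_)
    fun U t x hx => ?_
  · exact hM.toRat_injective U congr(($h).1.1)
  · have hw' : w.1.2 = 0 := hw
    obtain ⟨m, hm⟩ := hM.exists_section w.1.1 fun x hx => by
      obtain ⟨b, hb⟩ := QuotientAddGroup.mk_surjective (p.1 ⟨x, trivial⟩)
      rw [← QuotientAddGroup.eq_zero_iff, w.2 x hx, hw', ← hb, quotSmul_mk, map_zero, zero_smul]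
      rfl
    exact ⟨m, Subtype.ext (Prod.ext (funext fun h => hm h.down) hw'.symm)⟩
  · obtain ⟨V, hV, β, hxV, h⟩ := p.2 ⟨x, trivial⟩
    let t' : Γ(C, U) := t
    refine ⟨U ⊓ V, inf_le_left, ⟨hx, hxV⟩, ⟨((fun k => C.presheaf.germ U _ k.down.1 t' • β),
      fres inf_le_left t'), fun y hy => ?_⟩, rfl⟩
    rw [h y hy.2, quotSmul_fres, quotSmul_mk]

/-- The morphism `(r, u) ↦ r`, `u ↦ u p` to the sequence of principal parts. -/
noncomputable def mulToPrin : mulSeq p ⟶ prinSeq M where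
  τ₁ := 𝟙 _
  τ₂ := ⟨{ app := fun U => AddCommGrpCat.ofHom
             ((AddMonoidHom.fst (RatSec M U.unop) Γ(C, U.unop)).comp (mulSec p U.unop).subtype)
           naturality := fun _ _ _ => rfl }⟩
  τ₃ := ⟨{ app := fun U => AddCommGrpCat.ofHom (AddMonoidHom.mk'
             (fun r : Γ(C, U.unop) => (⟨fun x => quotSmul M x.2 r (p.1 ⟨x.1, trivial⟩), fun x => by
               obtain ⟨V, hV, β, hxV, h⟩ := p.2 ⟨x.1, trivial⟩
               refine ⟨U.unop ⊓ V, inf_le_left, C.presheaf.germ U.unop _ (generic_mem x.2) r • β,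
                 ⟨x.2, hxV⟩, fun y hy => ?_⟩
               exact congrArg (quotSmul M hy.1 r) (h y hy.2)⟩ : prinSec M U.unop))
             fun r s => Subtype.ext (funext fun x => quotSmul_add x.2 r s _))
           naturality := fun U V i => by
             ext r
             exact Subtype.ext (funext fun x => quotSmul_fres i.unop.le x.2 r _) }⟩
  comm₁₂ := rfl
  comm₂₃ := by
    refine Sheaf.hom_ext (NatTrans.ext (funext fun U => ?_))
    ext w
    exact Subtype.ext (funext fun x => w.2 x.1 x.2)

variable {G F : C.Modules}

lemma prinMap_apply {N : C.Modules} (i : M ⟶ N) {x : C} {β : RatStalk M}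
    (h : p.1 ⟨x, trivial⟩ = QuotientAddGroup.mk β) :
    (prinMap i p).1 ⟨x, trivial⟩ = QuotientAddGroup.mk (ratStalkMap i β) := by
  change QuotientAddGroup.map _ _ _ _ (p.1 _) = _
  rw [h]; rfl

/-- This is the membership of (r(a), u a) in W_q needed for `mulToHom`: apply i to r = u p modulo M,
evaluate at a, and move the scalar u from p to a. -/
lemma idSec_condition (i : M ⟶ homSheaf G F) {U : C.Opens} (w : mulSec p U) (V : C.Opens)
    (hV : V ≤ U) (a : Γ(G, V)) (x : C) (hx : x ∈ V) :
    (QuotientAddGroup.mk (stalkEv _ (ratStalkMap i (w.1.1 ⟨hV (generic_mem hx)⟩))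
        (G.presheaf.germ V _ (generic_mem hx) (ev (homOn (𝟙 G) U) hV a))) :
        RatStalk F ⧸ regAt F x) =
      prinEv x ((prinMap i p).1 ⟨x, trivial⟩)
        (G.presheaf.germ V x hx (ev (w.1.2 • homOn (𝟙 G) U) hV a)) := by
  obtain ⟨β, hβ⟩ := QuotientAddGroup.mk_surjective (p.1 ⟨x, trivial⟩)
  have e := w.2 x (hV hx)
  rw [← hβ, quotSmul_mk] at e
  have e' := congr(QuotientAddGroup.map _ _ (ratStalkMap i) (regAt_le_comap i x) $e)
  simp only [QuotientAddGroup.map_mk, ratStalkMap_smul] at e'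
  rw [prinMap_apply p i hβ.symm, prinEv_mk_germ, ev_homOn, ← prinEv_mk_germ x hx, e',
    prinEv_mk_germ, stalkEv_smul_left, ev_smul, germ_smul, germ_fres, ← germ_fres hV _ (generic_mem hx),
    stalkEv_smul]
  rfl

/-- The morphism `(r, u) ↦ (a ↦ (r(a), u a))`, `u ↦ u id` to the sequence defining the
extension class of `W_q`. -/
noncomputable def mulToHom (i : M ⟶ homSheaf G F) :
    mulSeq p ⟶ homSeq (extSeq (prinMap i p)) where
  τ₁ := (toAb C).map i
  τ₂ := ⟨{ app := fun U => AddCommGrpCat.ofHom (AddMonoidHom.mk' (fun w : mulSec p U.unop =>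
             extHom (q := prinMap i p) (fun h => ratStalkMap i (w.1.1 h)) (homOn (𝟙 G) U.unop)
               (w.1.2 • homOn (𝟙 G) U.unop)
               fun V hV a x hx => idSec_condition p i w V hV a x hx)
             fun v w => by
               refine hom_ext_ev fun V hV a => ext_section (funext fun k => ?_) ?_
               · change stalkEv _ (ratStalkMap i (v.1.1 _ + w.1.1 _)) _ = _
                 rw [map_add, map_add]; rfl
               · let a' : Γ(G, V) := a
                 change fres hV (v.1.2 + w.1.2) • a' = fres hV v.1.2 • a' + fres hV w.1.2 • a'
                 rw [map_add, add_smul])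
           naturality := fun U V k => by
             ext w
             refine hom_ext_ev fun W hW a => ext_section rfl ?_
             let w' : mulSec p U.unop := w
             let a' : Γ(G, W) := a
             change fres hW (fres k.unop.le w'.1.2) • a' = fres (hW.trans k.unop.le) w'.1.2 • a'
             rw [fres_fres] }⟩
  τ₃ := ⟨{ app := fun U => AddCommGrpCat.ofHom (AddMonoidHom.mk'
             (fun r : Γ(C, U.unop) => r • homOn (𝟙 G) U.unop) fun r s => add_smul (R := Γ(C, U.unop)) (M := Γ(homSheaf G G, U.unop)) r s _)
           naturality := fun U V k => by
             ext r
             refine hom_ext_ev fun W hW a => ?_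
             let r' : Γ(C, U.unop) := r
             let a' : Γ(G, W) := a
             change fres hW (fres k.unop.le r') • a' = fres (hW.trans k.unop.le) r' • a'
             rw [fres_fres] }⟩
  comm₁₂ := by
    refine Sheaf.hom_ext (NatTrans.ext (funext fun U => ?_))
    ext m
    let m' : Γ(M, U.unop) := m
    refine hom_ext_ev fun V hV a => ext_section (funext fun k => ?_) ?_
    · change F.presheaf.germ V _ k.down (ev (i.app U.unop m') hV a) =
        stalkEv _ (ratStalkMap i (M.presheaf.germ U.unop _ _ m')) (G.presheaf.germ V _ k.down a)
      rw [ratStalkMap_germ i (hV k.down)]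
      exact (stalkEv_germ_of_le _ hV k.down (i.app U.unop m') (a : Γ(G, V))).symm
    · change 0 = fres hV 0 • a
      rw [map_zero, zero_smul]
  comm₂₃ := rfl

/-- The class of the extension `W_q`, for `q` the image of a principal part `p ∈ Prin(M)` under
`i : M ⟶ ℋom(G, F)`, is the image of `[p]`. -/
lemma H1map_prinClass (hM : TorsionFree M) (i : M ⟶ homSheaf G F)
    (hE : (homSeq (extSeq (prinMap i p))).ShortExact) (hS : (prinSeq M).ShortExact) :
    H1map i (prinClass hS p) = extensionClass hE := by
  have h := mulSeq_shortExact p hM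
  -- The image of 1 under the connecting map of `mulSeq p` is computed twice. `mulToPrin` is the
  -- identity on M and sends 1 to p, so it is [p]; `mulToHom` is i on M and sends 1 to the identity,
  -- so i carries it to the extension class.
  have h1 := map_connecting h hS (mulToPrin p) (1 : Γ(C, ⊤))
  have h2 := map_connecting h hE (mulToHom p i) (1 : Γ(C, ⊤))
  have e1 : (mulToPrin p).τ₃.hom.app (op ⊤) (1 : Γ(C, ⊤)) = p :=
    Subtype.ext (funext fun x => quotSmul_one x.2 _)
  have e2 : (mulToHom p i).τ₃.hom.app (op ⊤) (1 : Γ(C, ⊤)) = idSec G :=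
    one_smul Γ(C, ⊤) (homOn (𝟙 G) ⊤)
  rw [e1] at h1
  erw [Sheaf.H.map_id_apply] at h1
  rw [e2] at h2
  rw [prinClass, ← h1]
  exact h2

end MultiplesOfPrincipalPart

/-! ### Transposition and symmetrization of L⁻¹ ⊗ F ⊗ F -/

section Transpose

variable {C : Scheme.{u}} {F L G : C.Modules} (h : Reflexive F L)

/-- The homomorphism `G ⟶ F` corresponding to a pairing `G ⟶ ℋom(ℋom(F, L), L)`. -/
noncomputable def Reflexive.ofForm {U : C.Opens}
    (B : Γ(homSheaf G (homSheaf (homSheaf F L) L), U)) : Γ(homSheaf G F, U) :=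
  mkHom (fun V hV =>
    { toFun := fun a => h.repr (ev B hV a)
      map_add' := fun a b => h.eq_of_forall fun W k c => by
        rw [map_add, map_add, map_add, h.ev_repr, h.ev_repr, h.ev_repr, ev_add]
      map_smul' := fun r a => h.eq_of_forall fun W k c => by
        rw [RingHom.id_apply, res_smul, map_smul, map_smul, h.ev_repr, h.ev_repr, ev_smul] })
    fun {V W} hV k a => h.eq_of_forall fun T k' c => by
      change ev c le_rfl (res F k' (res F k (h.repr _))) = ev c le_rfl (res F k' (h.repr _))
      rw [res_res, h.ev_repr, h.ev_repr, ← res_ev B hV k, ev_res]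

lemma Reflexive.ev_ofForm {U V : C.Opens} (B : Γ(homSheaf G (homSheaf (homSheaf F L) L), U))
    (k : V ≤ U) (a : Γ(G, V)) (b : Γ(homSheaf F L, V)) :
    ev b le_rfl (ev (h.ofForm B) k a) = ev (ev B k a) le_rfl b := by
  rw [← h.ev_repr (ev B k a) le_rfl b, res_id]
  rfl

/-- This reduces identities between maps into F to identities in L, where transposition simply
exchanges the two arguments. -/
lemma Reflexive.eq_of_ev {U : C.Opens} {φ ψ : Γ(homSheaf G F, U)}
    (H : ∀ (V : C.Opens) (k : V ≤ U) (a : Γ(G, V)) (b : Γ(homSheaf F L, V)),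
      ev b le_rfl (ev φ k a) = ev b le_rfl (ev ψ k a)) (h : Reflexive F L) : φ = ψ :=
  hom_ext_ev fun V hV a => h.eq_of_forall fun W k b => by
    rw [res_ev, res_ev, H]

/-- The transpose of a section of `L⁻¹ ⊗ F ⊗ F`. -/
noncomputable def Reflexive.transpose {U : C.Opens} (φ : Γ(tensorSheaf F L, U)) :
    Γ(tensorSheaf F L, U) :=
  -- The pairing that defines the transpose is (a, b) ↦ a(φ(b)).
  h.ofForm (mkHom (fun _ hV =>
    { toFun := fun a => homComp a (res _ hV φ)
      map_add' := fun _ _ => rfl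
      map_smul' := fun _ _ => rfl }) fun _ _ _ => rfl)

lemma Reflexive.ev_transpose {U V : C.Opens} (φ : Γ(tensorSheaf F L, U)) (k : V ≤ U)
    (a b : Γ(twistedDual F L, V)) :
    ev b le_rfl (ev (h.transpose φ) k a) = ev a le_rfl (ev φ k b) :=
  h.ev_ofForm _ k a b

lemma fres_half {c : Γ(C, ⊤)} (hc : 2 * c = 1) (U : C.Opens) :
    2 * fres (le_top : U ≤ ⊤) c = 1 := by
  rw [← map_one (fres (le_top : U ≤ ⊤)), ← hc, map_mul, map_ofNat]

/-- The symmetrization `L⁻¹ ⊗ F ⊗ F ⟶ L⁻¹ ⊗ Sym² F`, where `c` is one half. -/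
noncomputable def symmetrize (c : Γ(C, ⊤)) : tensorSheaf F L ⟶ symSheaf F L :=
  homMk (fun U =>
    { toFun := fun φ => (show symSec F L U from ⟨fres le_top c • (φ + h.transpose φ),
        fun V k a b => by
          rw [ev_smul, ev_smul, map_smul, map_smul, ev_add, ev_add, map_add, map_add,
            h.ev_transpose, h.ev_transpose, add_comm]⟩)
      map_add' := fun φ ψ => Subtype.ext <| Reflexive.eq_of_ev (fun V k a b => by
        change ev b le_rfl (ev (fres le_top c • (φ + ψ + h.transpose (φ + ψ))) k a) =
          ev b le_rfl (ev (fres le_top c • (φ + h.transpose φ) +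
            fres le_top c • (ψ + h.transpose ψ)) k a)
        simp only [ev_smul, ev_add, map_smul, map_add, h.ev_transpose, smul_add]
        abel) h
      map_smul' := fun r φ => Subtype.ext <| Reflexive.eq_of_ev (fun V k a b => by
        change ev b le_rfl (ev (fres le_top c • (r • φ + h.transpose (r • φ))) k a) =
          ev b le_rfl (ev (r • fres le_top c • (φ + h.transpose φ)) k a)
        simp only [ev_smul, ev_add, map_smul, map_add, h.ev_transpose, smul_add,
          smul_comm (fres k r)]) h })
    fun {U V} hUV φ => Subtype.ext <| Reflexive.eq_of_ev (fun W k a b => by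
      change ev b le_rfl
          (ev (fres (le_top : V ≤ ⊤) c • (res (tensorSheaf F L) hUV φ +
            h.transpose (res (tensorSheaf F L) hUV φ))) k a) =
        ev b le_rfl (ev (fres (le_top : U ≤ ⊤) c • (φ + h.transpose φ)) (k.trans hUV) a)
      simp only [ev_smul, ev_add, map_smul, map_add, h.ev_transpose, ev_res, fres_fres]) h

/-- A symmetric φ equals its transpose, so c (φ + φᵗ) = 2c φ = φ. The resulting retraction gives
injectivity on H¹, hence the uniqueness in (b). -/
lemma symIncl_symmetrize {c : Γ(C, ⊤)} (hc : 2 * c = 1) :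
    symIncl F L ≫ symmetrize h c = 𝟙 _ := by
  refine Scheme.Modules.hom_ext _ _ fun U => ?_
  ext φ
  let φ' : symSec F L U := φ
  refine Subtype.ext <| Reflexive.eq_of_ev (fun V k a b => ?_) h
  change ev b le_rfl (ev (fres le_top c • (φ'.1 + h.transpose φ'.1)) k a) =
    ev b le_rfl (ev φ'.1 k a)
  rw [ev_smul, ev_add, map_smul, map_add, h.ev_transpose, ← φ'.2, ← two_smul Γ(C, V), smul_smul,
    fres_fres, mul_comm, fres_half hc, one_smul]

/-- The structure morphism makes the ring of global functions a ℂ-algebra. -/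
lemma exists_half {C : Scheme.{0}} (f : C ⟶ Spec (CommRingCat.of ℂ)) : ∃ c : Γ(C, ⊤), 2 * c = 1 := by
  let g := ((Scheme.ΓSpecIso _).inv ≫ f.appTop).hom
  refine ⟨g (1 / 2 : ℂ), ?_⟩
  rw [← map_ofNat g 2, ← map_mul, ← map_one g]
  congr 1
  exact mul_one_div_cancel two_ne_zero

end Transpose

/-! ### The projection W → F^* ⊗ L, its kernel and its isotropic local splittings -/

section Quotient

variable {C : Scheme.{u}} {W L F : C.Modules} (ω : W ⟶ homSheaf W L) (j : F ⟶ W)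

/-- The map `W ⟶ F^* ⊗ L` given by `w ↦ ω(w, j(-))`. -/
noncomputable def dualProj : W ⟶ twistedDual F L :=
  homMk (fun U =>
    { toFun := fun w => homComp (ω.app U w) (homOn j U)
      map_add' := fun v w => by rw [map_add]; rfl
      map_smul' := fun r w => by rw [Scheme.Modules.Hom.app_smul]; rfl })
    fun h w => by
      change homComp (ω.app _ (res W h w)) _ = _
      rw [app_res]; rfl

variable {ω j}

lemma ev_dualProj {U V : C.Opens} (w : Γ(W, U)) (h : V ≤ U) (f : Γ(F, V)) :
    ev ((dualProj ω j).app U w) h f = ev (ω.app U w) h (j.app V f) := rfl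

lemma ev_dualProj_self {U : C.Opens} (w : Γ(W, U)) (f : Γ(F, U)) :
    ev ((dualProj ω j).app U w) le_rfl f = pairing ω w (j.app U f) := rfl

lemma pairing_res {U V : C.Opens} (h : V ≤ U) (v w : Γ(W, U)) :
    pairing ω (res W h v) (res W h w) = res L h (pairing ω v w) := by
  rw [pairing, pairing, res_ev, app_res]; rfl

lemma pairing_add_left {U : C.Opens} (v v' w : Γ(W, U)) :
    pairing ω (v + v') w = pairing ω v w + pairing ω v' w := by
  rw [pairing, map_add]; rfl

lemma pairing_sub_left {U : C.Opens} (v v' w : Γ(W, U)) :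
    pairing ω (v - v') w = pairing ω v w - pairing ω v' w := by
  rw [pairing, map_sub]; rfl

lemma pairing_smul_left {U : C.Opens} (r : Γ(C, U)) (v w : Γ(W, U)) :
    pairing ω (r • v) w = r • pairing ω v w := by
  rw [pairing, Scheme.Modules.Hom.app_smul, ev_smul, fres_id]; rfl

lemma pairing_add_right {U : C.Opens} (v w w' : Γ(W, U)) :
    pairing ω v (w + w') = pairing ω v w + pairing ω v w' := map_add _ _ _

lemma pairing_sub_right {U : C.Opens} (v w w' : Γ(W, U)) :
    pairing ω v (w - w') = pairing ω v w - pairing ω v w' := map_sub _ _ _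

lemma pairing_smul_right {U : C.Opens} (r : Γ(C, U)) (v w : Γ(W, U)) :
    pairing ω v (r • w) = r • pairing ω v w := map_smul _ _ _

lemma dualProj_comp_of_isotropic
    (h : ∀ (U : C.Opens) (f g : Γ(F, U)), pairing ω (j.app U f) (j.app U g) = 0) {U : C.Opens}
    (f : Γ(F, U)) : (dualProj ω j).app U (j.app U f) = 0 :=
  hom_ext_ev fun V hV g => by
    rw [ev_dualProj, ev_zero, ← ev_res_self, ← app_res, ← app_res]
    exact h V _ g

lemma IsSubbundle.isVectorBundle {n : ℕ} (h : IsSubbundle j n) : IsVectorBundle F n := fun x => by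
  obtain ⟨U, s, e, e', hx, he, -⟩ := h x
  exact ⟨U, e, hx, he⟩

/-- A subbundle is locally a direct summand. -/
lemma IsSubbundle.exists_retraction {n : ℕ} (h : IsSubbundle j n) (x : C) :
    ∃ (U : C.Opens) (ρ : Γ(homSheaf W F, U)), x ∈ U ∧
      ∀ (V : C.Opens) (hV : V ≤ U) (f : Γ(F, V)), ev ρ hV (j.app V f) = f := by
  obtain ⟨U, s, e, e', hx, he, he'⟩ := h x
  refine ⟨U, he'.hom (Sum.elim e 0), hx, fun V hV f => ?_⟩
  have : homComp (he'.hom (Sum.elim e 0)) (homOn j U) = homOn (𝟙 F) U := by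
    refine he.hom_ext fun i => ?_
    rw [ev_homComp, ev_homOn, ev_homOn]
    exact he'.ev_hom_self (Sum.elim e 0) (Sum.inl i)
  exact congr(ev $this hV f)

/-- A local section of `W ⟶ F^* ⊗ L` from a local retraction of `F ⟶ W`. -/
noncomputable def sectionOfRetraction [IsIso ω] {U : C.Opens} (ρ : Γ(homSheaf W F, U)) :
    Γ(homSheaf (twistedDual F L) W, U) :=
  homComp (homOn (inv ω) U) (mkHom (fun V hV =>
    { toFun := fun a : Γ(homSheaf F L, V) => homComp a (res _ hV ρ)
      map_add' := fun _ _ => rfl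
      map_smul' := fun _ _ => rfl }) fun _ _ _ => rfl)

lemma app_inv_app [IsIso ω] {U : C.Opens} (φ : Γ(homSheaf W L, U)) :
    ω.app U ((inv ω).app U φ) = φ :=
  congr(($(IsIso.inv_hom_id ω)).app U φ)

/-- The lift of a is the vector v with ω(v, ·) = a ∘ ρ, and then ω(v, j f) = a(ρ(j f)) = a(f). -/
lemma dualProj_sectionOfRetraction [IsIso ω] {U : C.Opens} {ρ : Γ(homSheaf W F, U)}
    (hρ : ∀ (V : C.Opens) (hV : V ≤ U) (f : Γ(F, V)), ev ρ hV (j.app V f) = f)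
    {V : C.Opens} (hV : V ≤ U) (a : Γ(twistedDual F L, V)) :
    (dualProj ω j).app V (ev (sectionOfRetraction (ω := ω) ρ) hV a) = a := by
  refine hom_ext_ev fun T hT f => ?_
  rw [ev_dualProj, sectionOfRetraction, ev_homComp, ev_homOn, app_inv_app]
  change ev a hT (ev ρ (hT.trans hV) (j.app T f)) = ev a hT f
  rw [hρ]

/-- A surjective linear map between free modules of the same finite rank is injective. -/
lemma injective_of_surjective_of_card_eq {R M N : Type*} [CommRing R] [AddCommGroup M]
    [AddCommGroup N] [Module R M] [Module R N] {ι κ : Type*} [Fintype ι] [Fintype κ]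
    (b : Module.Basis ι R M) (c : Module.Basis κ R N) (h : Fintype.card ι = Fintype.card κ)
    (f : M →ₗ[R] N) (hf : Function.Surjective f) : Function.Injective f := by
  let e := c.equiv b (Fintype.equivOfCardEq h.symm)
  have : Module.Finite R M := Module.Finite.of_basis b
  have := OrzechProperty.injective_of_surjective_endomorphism (e.toLinearMap.comp f)
    (e.surjective.comp hf)
  exact Function.Injective.of_comp (f := e) this

/-- The map (ρ, projection) from W(U) to F(U) × (F^* ⊗ L)(U) is surjective between free modules of
rank 2n, hence injective. It takes the same value at v and at j(ρ(v)) when v projects to zero. -/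
lemma eq_of_dualProj_eq_zero [IsIso ω] {n : ℕ} {U : C.Opens} {e : Fin n → Γ(F, U)}
    (he : IsFrame F e) {l : Fin 1 → Γ(L, U)} (hl : IsFrame L l) {w : Fin (2 * n) → Γ(W, U)}
    (hw : IsFrame W w) {ρ : Γ(homSheaf W F, U)}
    (hρ : ∀ (V : C.Opens) (hV : V ≤ U) (f : Γ(F, V)), ev ρ hV (j.app V f) = f)
    (iso : ∀ f : Γ(F, U), (dualProj ω j).app U (j.app U f) = 0)
    (v : Γ(W, U)) (hv : (dualProj ω j).app U v = 0) : j.app U (ev ρ le_rfl v) = v := by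
  let S : Γ(W, U) →ₗ[Γ(C, U)] Γ(F, U) × Γ(twistedDual F L, U) :=
    (ev ρ le_rfl).prod (appLin (dualProj ω j) U)
  let b : Module.Basis (Fin n ⊕ Σ _ : Fin n, Fin 1) Γ(C, U) (Γ(F, U) × Γ(twistedDual F L, U)) :=
    (he.basis le_rfl).prod ((Pi.basis fun _ => hl.basis le_rfl).map he.homEquiv.symm)
  have hS : Function.Surjective S := fun ⟨f, a⟩ => by
    let s := ev (sectionOfRetraction (ω := ω) ρ) le_rfl a
    have hs : (dualProj ω j).app U s = a := dualProj_sectionOfRetraction hρ le_rfl a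
    -- Adding an element of F to the lift s of a adjusts the first component to f; by isotropy it
    -- leaves the projection unchanged.
    refine ⟨s + j.app U (f - ev ρ le_rfl s), Prod.ext ?_ ?_⟩
    · change ev ρ le_rfl (s + j.app U (f - ev ρ le_rfl s)) = f
      rw [map_add, hρ, add_sub_cancel]
    · change (dualProj ω j).app U (s + j.app U (f - ev ρ le_rfl s)) = a
      rw [map_add, iso, hs, add_zero]
  have inj := injective_of_surjective_of_card_eq (hw.basis le_rfl) b (by simp; omega) S hS
  refine inj (Prod.ext (hρ U le_rfl _) ?_)
  change (dualProj ω j).app U (j.app U _) = (dualProj ω j).app U v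
  rw [iso, hv]

variable (ω j) in
/-- The sequence `0 → F → W → F^* ⊗ L` is exact on sections, `F` is isotropic and `ω` is
skew-symmetric. -/
structure IsLagrangianSequence : Prop where
  skew : ∀ (U : C.Opens) (v w : Γ(W, U)), pairing ω v w = -pairing ω w v
  isotropic : ∀ (U : C.Opens) (f : Γ(F, U)), (dualProj ω j).app U (j.app U f) = 0
  injective : ∀ U, Function.Injective (j.app U)
  exact : ∀ (U : C.Opens) (w : Γ(W, U)), (dualProj ω j).app U w = 0 →
    ∃ f : Γ(F, U), j.app U f = w

/-- Local retractions recover a section of F from its image. -/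
lemma IsSubbundle.app_injective {n : ℕ} (h : IsSubbundle j n) (U : C.Opens) :
    Function.Injective (j.app U) := by
  choose T ρ hx hρ using h.exists_retraction
  intro f g hfg
  refine sep F (fun x : C => U ⊓ T x) (fun x => inf_le_left) ?_ _ _ fun x => ?_
  · rw [← inf_iSup_eq]
    exact le_inf le_rfl fun x _ => Opens.mem_iSup.2 ⟨x, hx x⟩
  rw [← hρ x _ inf_le_right (res F inf_le_left f), ← hρ x _ inf_le_right (res F inf_le_left g),
    app_res, app_res, hfg]

/-- Only exactness in the middle needs work. It holds wherever F, L and W all have frames and F is a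
summand, and the local preimages in F glue because `j` is injective on sections. -/
lemma IsLagrangian.isLagrangianSequence {n : ℕ} (hL : IsVectorBundle L 1)
    (hW : IsVectorBundle W (2 * n)) (hω : IsSymplectic ω) (hj : IsLagrangian n ω j) :
    IsLagrangianSequence ω j := by
  have inj := hj.subbundle.app_injective
  have iso := fun U f => dualProj_comp_of_isotropic (ω := ω) (j := j) hj.isotropic (U := U) f
  have := hω.nondegenerate
  refine ⟨hω.skew, iso, inj, fun U w hw => ?_⟩
  choose T₁ ρ hx₁ hρ using hj.subbundle.exists_retraction
  choose T₂ e hx₂ he using hj.subbundle.isVectorBundle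
  choose T₃ l hx₃ hl using hL
  choose T₄ v hx₄ hv using hW
  let T : C → C.Opens := fun x => U ⊓ (T₁ x ⊓ T₂ x ⊓ (T₃ x ⊓ T₄ x))
  have hT₁ : ∀ x, T x ≤ T₁ x := fun x => inf_le_right.trans (inf_le_left.trans inf_le_left)
  have hT₂ : ∀ x, T x ≤ T₂ x := fun x => inf_le_right.trans (inf_le_left.trans inf_le_right)
  have hT₃ : ∀ x, T x ≤ T₃ x := fun x => inf_le_right.trans (inf_le_right.trans inf_le_left)
  have hT₄ : ∀ x, T x ≤ T₄ x := fun x => inf_le_right.trans (inf_le_right.trans inf_le_right)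
  have cov : U ≤ iSup T := by
    rw [← inf_iSup_eq]
    exact le_inf le_rfl fun x _ => Opens.mem_iSup.2 ⟨x, ⟨hx₁ x, hx₂ x⟩, hx₃ x, hx₄ x⟩
  have key : ∀ x, ∃ f : Γ(F, T x), j.app (T x) f = res W inf_le_left w := fun x =>
    ⟨_, eq_of_dualProj_eq_zero ((he x).restrict (hT₂ x)) ((hl x).restrict (hT₃ x))
      ((hv x).restrict (hT₄ x)) (ρ := res _ (hT₁ x) (ρ x))
      (fun V hV f => hρ x V (hV.trans (hT₁ x)) f) (iso (T x)) (res W inf_le_left w)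
      (by rw [app_res, hw, map_zero])⟩
  choose f hf using key
  obtain ⟨g, hg⟩ := glue F T (fun x => inf_le_left) cov f fun x y => inj _ (by
    rw [app_res, app_res, hf, hf, res_res, res_res])
  refine ⟨g, sep W T (fun x => inf_le_left) cov _ _ fun x => ?_⟩
  rw [← app_res, hg, hf]

/-- A section over `U` of `W ⟶ F^* ⊗ L` with isotropic image. -/
structure IsLagrangianSection (ω : W ⟶ homSheaf W L) (j : F ⟶ W) {U : C.Opens}
    (σ : Γ(homSheaf (twistedDual F L) W, U)) : Prop where
  proj : ∀ (V : C.Opens) (h : V ≤ U) (a : Γ(twistedDual F L, V)),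
    (dualProj ω j).app V (ev σ h a) = a
  isotropic : ∀ (V : C.Opens) (h : V ≤ U) (a b : Γ(twistedDual F L, V)),
    pairing ω (ev σ h a) (ev σ h b) = 0

lemma IsLagrangianSection.restrict {U V : C.Opens} {σ : Γ(homSheaf (twistedDual F L) W, U)}
    (hσ : IsLagrangianSection ω j σ) (h : V ≤ U) : IsLagrangianSection ω j (res _ h σ) :=
  ⟨fun T k a => hσ.proj T (k.trans h) a, fun T k a b => hσ.isotropic T (k.trans h) a b⟩

/-- Every lift of a pairs with F in the same way, whichever splitting produced it; this turns values
of ω into values of the duality pairing. -/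
lemma pairing_section {U : C.Opens} {v : Γ(W, U)} {a : Γ(twistedDual F L, U)}
    (hv : (dualProj ω j).app U v = a) (f : Γ(F, U)) : pairing ω v (j.app U f) = ev a le_rfl f := by
  rw [← hv, ev_dualProj_self]

lemma exists_isLagrangianSection {c : Γ(C, ⊤)} (hc : 2 * c = 1) (hr : Reflexive F L)
    (h : IsLagrangianSequence ω j) {U : C.Opens} (σ : Γ(homSheaf (twistedDual F L) W, U))
    (hσ : ∀ (V : C.Opens) (h : V ≤ U) (a : Γ(twistedDual F L, V)),
      (dualProj ω j).app V (ev σ h a) = a) :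
    ∃ σ' : Γ(homSheaf (twistedDual F L) W, U), IsLagrangianSection ω j σ' := by
  -- B is the form (a, b) ↦ -ω(σ a, σ b), and biduality turns it into τ : F^* ⊗ L → F. With this
  -- sign both ω(σ a, j τ b) and ω(j τ a, σ b) equal ω(σ a, σ b), so σ - c j τ is isotropic exactly
  -- because 2c = 1.
  let B : Γ(homSheaf (twistedDual F L) (homSheaf (homSheaf F L) L), U) :=
    mkHom (fun V hV =>
      { toFun := fun a => homComp (-(ω.app V (ev σ hV a))) (res _ hV σ)
        map_add' := fun a b => by
          rw [map_add, map_add, neg_add]; rfl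
        map_smul' := fun r a => by
          rw [map_smul, Scheme.Modules.Hom.app_smul, ← smul_neg]; rfl })
      fun {V T} hV k a => by
        change homComp (res _ k (-(ω.app V (ev σ hV a)))) (res _ (k.trans hV) σ) = _
        rw [map_neg, ← app_res, res_ev]; rfl
  let τ := hr.ofForm B
  have hτ : ∀ (V : C.Opens) (hV : V ≤ U) (a b : Γ(twistedDual F L, V)),
      ev b le_rfl (ev τ hV a) = -pairing ω (ev σ hV a) (ev σ hV b) := fun V hV a b =>
    hr.ev_ofForm B hV a b
  have hσ' : ∀ (V : C.Opens) (hV : V ≤ U) (a : Γ(twistedDual F L, V)),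
      ev (σ - fres (le_top : U ≤ ⊤) c • homComp (homOn j U) τ) hV a =
        ev σ hV a - fres (le_top : V ≤ ⊤) c • j.app V (ev τ hV a) := fun V hV a => by
    rw [ev_sub, ev_smul, fres_fres]; rfl
  refine ⟨σ - fres (le_top : U ≤ ⊤) c • homComp (homOn j U) τ, fun V hV a => ?_, fun V hV a b => ?_⟩
  · rw [hσ', map_sub, Scheme.Modules.Hom.app_smul, h.isotropic, smul_zero, sub_zero, hσ]
  · have e1 := pairing_section (hσ V hV a) (ev τ hV b)
    have e2 := pairing_section (hσ V hV b) (ev τ hV a)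
    have e3 := pairing_section (h.isotropic V (ev τ hV a)) (ev τ hV b)
    rw [ev_zero] at e3
    rw [hτ] at e1 e2
    have e4 := fres_half hc V
    rw [h.skew V (ev σ hV b), neg_neg] at e1
    rw [hσ', hσ', pairing_sub_left, pairing_sub_right, pairing_sub_right, pairing_smul_left,
      pairing_smul_right, pairing_smul_left, pairing_smul_right, e3, e1,
      h.skew V (j.app V _), e2, smul_zero, smul_zero, sub_zero, neg_neg]
    have : ∀ z : Γ(L, V), z - fres (le_top : V ≤ ⊤) c • z - fres (le_top : V ≤ ⊤) c • z = 0 := fun z => by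
      rw [sub_sub, ← two_smul Γ(C, V), smul_smul, e4, one_smul, sub_self]
    exact this _

/-- The difference of two Lagrangian sections is a symmetric homomorphism `F^* ⊗ L ⟶ F`. -/
lemma IsLagrangianSequence.exists_difference (h : IsLagrangianSequence ω j) {U : C.Opens}
    {σ τ : Γ(homSheaf (twistedDual F L) W, U)} (hσ : IsLagrangianSection ω j σ)
    (hτ : IsLagrangianSection ω j τ) :
    ∃ φ : symSec F L U, ∀ (V : C.Opens) (hV : V ≤ U) (a : Γ(twistedDual F L, V)),
      j.app V (ev φ.1 hV a) = ev σ hV a - ev τ hV a := by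
  have key : ∀ (V : C.Opens) (hV : V ≤ U) (a : Γ(twistedDual F L, V)), ∃ f : Γ(F, V),
      j.app V f = ev σ hV a - ev τ hV a := fun V hV a =>
    h.exact V _ (by rw [map_sub, hσ.proj, hτ.proj, sub_self])
  choose r hr using key
  let φ : Γ(tensorSheaf F L, U) := mkHom (fun V hV =>
    { toFun := r V hV
      map_add' := fun a b => h.injective V (by
        rw [map_add, hr, hr, hr, map_add, map_add]; abel)
      map_smul' := fun c a => h.injective V (by
        rw [RingHom.id_apply, Scheme.Modules.Hom.app_smul, hr, hr, map_smul, map_smul,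
          smul_sub]) })
    fun {V T} hV k a => h.injective T (by
      change j.app T (res F k (r V hV a)) = j.app T (r T _ (res _ k a))
      rw [app_res, hr, hr, map_sub, res_ev, res_ev])
  have hφ : ∀ (V : C.Opens) (hV : V ≤ U) (a : Γ(twistedDual F L, V)),
      j.app V (ev φ hV a) = ev σ hV a - ev τ hV a := hr
  refine ⟨⟨φ, fun V hV a b => ?_⟩, hφ⟩
  -- Lifting b by σ and a by τ, isotropy leaves -ω(σ b, τ a) on one side and ω(τ a, σ b) on the
  -- other; these agree by skew symmetry.
  rw [← pairing_section (hσ.proj V hV b) (ev φ hV a), ← pairing_section (hτ.proj V hV a) (ev φ hV b),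
    hφ, hφ, pairing_sub_right, pairing_sub_right, hσ.isotropic, hτ.isotropic, zero_sub, sub_zero,
    h.skew V (ev τ hV a)]

end Quotient

/-! ### Transport of symplectic forms along isomorphisms -/

section Transport

variable {C : Scheme.{u}} {W W' L : C.Modules}

/-- The morphism `ℋom(M, N) ⟶ ℋom(M', N)` given by composition with `f : M' ⟶ M`. -/
noncomputable def homSheafPre {M M' : C.Modules} (N : C.Modules) (f : M' ⟶ M) :
    homSheaf M N ⟶ homSheaf M' N :=
  homMk (fun U =>
    { toFun := fun φ => homComp φ (homOn f U)
      map_add' := fun _ _ => rfl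
      map_smul' := fun _ _ => rfl }) fun _ _ => rfl

instance {M M' : C.Modules} (N : C.Modules) (f : M' ⟶ M) [IsIso f] : IsIso (homSheafPre N f) := by
  refine ⟨homSheafPre N (inv f), Scheme.Modules.hom_ext _ _ fun U => ?_,
    Scheme.Modules.hom_ext _ _ fun U => ?_⟩
  · ext φ
    exact hom_ext_ev fun V hV m =>
      congrArg (ev (M := M) (N := N) φ hV) congr(($(IsIso.inv_hom_id f)).app V m)
  · ext φ
    exact hom_ext_ev fun V hV m =>
      congrArg (ev (M := M') (N := N) φ hV) congr(($(IsIso.hom_inv_id f)).app V m)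

/-- The form on `W'` corresponding to a form on `W` under an isomorphism. -/
noncomputable def transportForm (ι : W ≅ W') (ω : W ⟶ homSheaf W L) : W' ⟶ homSheaf W' L :=
  ι.inv ≫ ω ≫ homSheafPre L ι.inv

lemma pairing_transportForm (ι : W ≅ W') (ω : W ⟶ homSheaf W L) {U : C.Opens} (v w : Γ(W', U)) :
    pairing (transportForm ι ω) v w = pairing ω (ι.inv.app U v) (ι.inv.app U w) := rfl

lemma IsSymplectic.transportForm {ω : W ⟶ homSheaf W L} (hω : IsSymplectic ω) (ι : W ≅ W') :
    IsSymplectic (transportForm ι ω) where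
  skew U v w := by rw [pairing_transportForm, hω.skew]; rfl
  nondegenerate := by
    have := hω.nondegenerate
    rw [SympExt.transportForm]
    infer_instance

lemma hom_inv_app (ι : W ≅ W') {U : C.Opens} (w : Γ(W, U)) : ι.inv.app U (ι.hom.app U w) = w :=
  congr(($(ι.hom_inv_id)).app U w)

lemma inv_hom_app (ι : W ≅ W') {U : C.Opens} (w : Γ(W', U)) : ι.hom.app U (ι.inv.app U w) = w :=
  congr(($(ι.inv_hom_id)).app U w)

end Transport

/-! ### The principal part of a Lagrangian subbundle and the isomorphism W ≅ W_p -/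

section PrincipalPart

variable {C : Scheme.{u}} {W L F : C.Modules} {ω : W ⟶ homSheaf W L}
  {j : F ⟶ W}

lemma mem_inf {X : Type*} [TopologicalSpace X] {U V : Opens X} {x : X} (hU : x ∈ U)
    (hV : x ∈ V) : x ∈ U ⊓ V := ⟨hU, hV⟩

/-- The section `w - σ₀(w mod F)` of `F` over `U ∩ U₀`. -/
lemma IsLagrangianSequence.exists_fst (h : IsLagrangianSequence ω j) {U₀ : C.Opens}
    {σ₀ : Γ(homSheaf (twistedDual F L) W, U₀)} (hσ₀ : IsLagrangianSection ω j σ₀) (U : C.Opens)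
    (w : Γ(W, U)) : ∃ f : Γ(F, U ⊓ U₀), j.app _ f =
      res W inf_le_left w - ev σ₀ inf_le_right (res _ inf_le_left ((dualProj ω j).app U w)) :=
  h.exact _ _ (by rw [map_sub, hσ₀.proj, app_res, sub_self])

/-- The `F`-component of `w` in the splitting of `W` over `U₀` given by `σ₀`. -/
noncomputable def fstSec (h : IsLagrangianSequence ω j) {U₀ : C.Opens}
    {σ₀ : Γ(homSheaf (twistedDual F L) W, U₀)} (hσ₀ : IsLagrangianSection ω j σ₀) {U : C.Opens}
    (w : Γ(W, U)) : Γ(F, U ⊓ U₀) := (h.exists_fst hσ₀ U w).choose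

variable (h : IsLagrangianSequence ω j) {U₀ : C.Opens}
  {σ₀ : Γ(homSheaf (twistedDual F L) W, U₀)} (hσ₀ : IsLagrangianSection ω j σ₀)

lemma app_fstSec {U : C.Opens} (w : Γ(W, U)) : j.app _ (fstSec h hσ₀ w) =
    res W inf_le_left w - ev σ₀ inf_le_right (res _ inf_le_left ((dualProj ω j).app U w)) :=
  (h.exists_fst hσ₀ U w).choose_spec

lemma res_fstSec {U V : C.Opens} (k : V ≤ U) (w : Γ(W, U)) :
    res F (inf_le_inf_right U₀ k) (fstSec h hσ₀ w) = fstSec h hσ₀ (res W k w) := by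
  refine h.injective _ ?_
  rw [app_res, app_fstSec, app_fstSec, map_sub, res_ev, res_res, res_res, app_res, res_res, res_res]

/-- The sequence `0 → F → W → F^* ⊗ L → 0` is exact. -/
lemma IsLagrangianSequence.shortExact (h : IsLagrangianSequence ω j)
    (loc : ∀ x : C, ∃ (U : C.Opens) (σ : Γ(homSheaf (twistedDual F L) W, U)), x ∈ U ∧
      IsLagrangianSection ω j σ) (w : j ≫ dualProj ω j = 0) :
    (ShortComplex.mk j (dualProj ω j) w).ShortExact := by
  refine shortExact_modules h.injective h.exact fun U t x hx => ?_
  obtain ⟨V, σ, hxV, hσ⟩ := loc x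
  exact ⟨U ⊓ V, inf_le_left, ⟨hx, hxV⟩, ev σ inf_le_right (res _ inf_le_left t), hσ.proj _ _ _⟩

variable [IrreducibleSpace C]

/-- The condition that the principal part `p` measures the difference between `σ₀` and local
Lagrangian sections of `W ⟶ F^* ⊗ L`. -/
def IsPrincipalPartOf (σ₀ : Γ(homSheaf (twistedDual F L) W, U₀))
    (p : Prin (symSheaf F L)) (ω : W ⟶ homSheaf W L) (j : F ⟶ W) : Prop :=
  ∀ x : C, ∃ (V : C.Opens) (_ : x ∈ V) (hV : genericPoint C ∈ V ⊓ U₀)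
    (σ : Γ(homSheaf (twistedDual F L) W, V)) (φ : symSec F L (V ⊓ U₀)),
    IsLagrangianSection ω j σ ∧
    (∀ (T : C.Opens) (hT : T ≤ V ⊓ U₀) (a : Γ(twistedDual F L, T)), j.app T (ev φ.1 hT a) =
      ev σ (hT.trans inf_le_left) a - ev σ₀ (hT.trans inf_le_right) a) ∧
    p.1 ⟨x, trivial⟩ = QuotientAddGroup.mk ((symSheaf F L).presheaf.germ _ _ hV φ)

/-- The value of p at x is the class of σ_x - σ₀. What has to be checked is that this rational
section also represents p at all points of V_x. -/
lemma exists_principalPart (h : IsLagrangianSequence ω j)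
    (hσ₀ : IsLagrangianSection ω j σ₀) (hU₀ : genericPoint C ∈ U₀)
    (loc : ∀ x : C, ∃ (U : C.Opens) (σ : Γ(homSheaf (twistedDual F L) W, U)), x ∈ U ∧
      IsLagrangianSection ω j σ) :
    ∃ p : Prin (symSheaf F L), IsPrincipalPartOf σ₀ p ω j := by
  choose V σ hxV hσ using loc
  have hη : ∀ x, genericPoint C ∈ V x ⊓ U₀ := fun x => ⟨generic_mem (hxV x), hU₀⟩
  choose φ hφ using fun x => h.exists_difference
    ((hσ x).restrict (inf_le_left : V x ⊓ U₀ ≤ V x)) (hσ₀.restrict inf_le_right)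
  let φ' : ∀ x, Γ(symSheaf F L, V x ⊓ U₀) := φ
  let β : C → RatStalk (symSheaf F L) := fun x => (symSheaf F L).presheaf.germ _ _ (hη x) (φ' x)
  refine ⟨⟨fun x => QuotientAddGroup.mk (β x.1), fun x => ?_⟩, fun x =>
    ⟨V x, hxV x, hη x, σ x, φ x, hσ x, hφ x, rfl⟩⟩
  refine ⟨V x.1, le_top, β x.1, hxV x.1, fun y hy => ?_⟩
  refine QuotientAddGroup.eq.2 ?_
  -- For y in V_x the representatives at x and y differ by σ_x - σ_y. The splitting σ₀ cancels, so
  -- this difference is a symmetric section ψ over V_x ∩ V_y, regular at y.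
  obtain ⟨ψ, hψ⟩ := h.exists_difference
    ((hσ x.1).restrict (inf_le_left : V x.1 ⊓ V y ≤ V x.1)) ((hσ y).restrict inf_le_right)
  have hT : genericPoint C ∈ V x.1 ⊓ V y := generic_mem (mem_inf hy (hxV y))
  have hTU : genericPoint C ∈ V x.1 ⊓ V y ⊓ U₀ := ⟨hT, hU₀⟩
  let ψ' : Γ(symSheaf F L, V x.1 ⊓ V y) := ψ
  have e : -β y + β x.1 = (symSheaf F L).presheaf.germ _ _ hT ψ' := by
    have k₁ : V x.1 ⊓ V y ⊓ U₀ ≤ V x.1 ⊓ U₀ := inf_le_inf_right _ inf_le_left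
    have k₂ : V x.1 ⊓ V y ⊓ U₀ ≤ V y ⊓ U₀ := inf_le_inf_right _ inf_le_right
    change -(symSheaf F L).presheaf.germ _ _ (hη y) (φ' y) +
      (symSheaf F L).presheaf.germ _ _ (hη x.1) (φ' x.1) = _
    rw [neg_add_eq_sub, ← germ_res _ (inf_le_left : V x.1 ⊓ V y ⊓ U₀ ≤ _) _ hTU,
      ← germ_res _ k₁ _ hTU, ← germ_res _ k₂ _ hTU, ← map_sub]
    congr 1
    refine Subtype.ext (hom_ext_ev fun S hS a => h.injective S ?_)
    change j.app S (ev (φ x.1).1 (hS.trans k₁) a - ev (φ y).1 (hS.trans k₂) a) =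
      j.app S (ev ψ.1 (hS.trans inf_le_left) a)
    rw [map_sub, hφ, hφ, hψ]
    simp only [ev_res]
    abel
  rw [e]
  exact germ_mem_regAt (M := symSheaf F L) (mem_inf hy (hxV y)) hT ψ

variable {p : Prin (symSheaf F L)}

lemma germ_fstSec_congr {U T : C.Opens} (w : Γ(W, U)) (k : T ≤ U ⊓ U₀) (hT : genericPoint C ∈ T) :
    F.presheaf.germ _ _ (k hT) (fstSec h hσ₀ w) = F.presheaf.germ T _ hT
      (res F k (fstSec h hσ₀ w)) := (germ_res F k _ hT _).symm

/-- With a the projection of w, subtracting (σ - σ₀)(a) from w - σ₀(a) gives w - σ(a), which is a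
regular section g of F near x. -/
lemma fstSec_condition (hp : IsPrincipalPartOf σ₀ p ω j) (hU₀ : genericPoint C ∈ U₀)
    {U : C.Opens} (w : Γ(W, U)) (x : C) (hx : x ∈ U) :
    (QuotientAddGroup.mk (F.presheaf.germ (U ⊓ U₀) _ (mem_inf (generic_mem hx) hU₀) (fstSec h hσ₀ w)) :
      RatStalk F ⧸ regAt F x) = prinEv x ((symPrin p).1 ⟨x, trivial⟩)
        ((twistedDual F L).presheaf.germ U x hx ((dualProj ω j).app U w)) := by
  obtain ⟨V, hxV, hηV, σ, φ, hσ, hφ, e⟩ := hp x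
  rw [prinMap_apply p (symIncl F L) e, prinEv_mk_germ]
  have hηU : genericPoint C ∈ U := generic_mem hx
  have hT : genericPoint C ∈ U ⊓ V ⊓ U₀ := ⟨⟨hηU, hηV.1⟩, hU₀⟩
  have k₁ : U ⊓ V ⊓ U₀ ≤ U ⊓ U₀ := inf_le_inf_right _ inf_le_left
  have k₂ : U ⊓ V ⊓ U₀ ≤ V ⊓ U₀ := inf_le_inf_right _ inf_le_right
  have k₃ : U ⊓ V ⊓ U₀ ≤ U := inf_le_left.trans inf_le_left
  obtain ⟨g, hg⟩ := h.exact (U ⊓ V) (res W inf_le_left w -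
    ev σ inf_le_right (res _ inf_le_left ((dualProj ω j).app U w)))
    (by rw [map_sub, hσ.proj, app_res, sub_self])
  have hxUV : x ∈ U ⊓ V := ⟨hx, hxV⟩
  refine QuotientAddGroup.eq.2 ?_
  -- Equality of cosets is stated as -(w - σ₀ a) + (σ - σ₀) a being regular; this element is -g.
  rw [← neg_mem_iff]
  convert germ_mem_regAt (M := F) hxUV ⟨hηU, hηV.1⟩ g using 1
  erw [ratStalkMap_germ (symIncl F L) hηV φ]
  rw [← germ_res _ k₃ _ hT]
  erw [stalkEv_germ_of_le _ k₂ hT φ.1]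
  rw [germ_fstSec_congr h hσ₀ w k₁ hT, ← germ_res F (inf_le_left : U ⊓ V ⊓ U₀ ≤ U ⊓ V) _ hT,
    ← map_neg, ← map_add, ← map_neg]
  congr 1
  refine h.injective _ ?_
  rw [map_neg, map_add, map_neg, hφ, app_res, app_res, app_fstSec, hg, map_sub, map_sub, res_ev,
    res_ev, res_res, res_res, res_res, res_res]
  abel

/-- The map `W ⟶ W_p`, `w ↦ (w - σ₀(w mod F), w mod F)`. -/
noncomputable def toExt (hp : IsPrincipalPartOf σ₀ p ω j) (hU₀ : genericPoint C ∈ U₀) :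
    W ⟶ sympSheaf p :=
  homMk (fun U =>
    { toFun := fun w => extMk
        (fun k => F.presheaf.germ (U ⊓ U₀) _ (mem_inf k.down hU₀) (fstSec h hσ₀ w))
        ((dualProj ω j).app U w) fun x hx => fstSec_condition h hσ₀ hp hU₀ w x hx
      map_add' := fun v w => ext_section (funext fun k => by
        have e : fstSec h hσ₀ (v + w) = fstSec h hσ₀ v + fstSec h hσ₀ w := h.injective _ (by
          simp only [map_add, app_fstSec]; abel)
        change F.presheaf.germ _ _ _ (fstSec h hσ₀ (v + w)) = _
        rw [e, map_add]; rfl) (map_add ((dualProj ω j).app U).hom v w)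
      map_smul' := fun r w => ext_section (funext fun k => by
        have e : fstSec h hσ₀ (r • w) = fres inf_le_left r • fstSec h hσ₀ w := h.injective _ (by
          rw [app_fstSec, Scheme.Modules.Hom.app_smul, Scheme.Modules.Hom.app_smul, app_fstSec,
            res_smul, res_smul, map_smul, smul_sub])
        change F.presheaf.germ _ _ _ (fstSec h hσ₀ (r • w)) = _
        rw [e, germ_smul, germ_fres]; rfl) (Scheme.Modules.Hom.app_smul (dualProj ω j) r w) })
    fun {U V} k w => ext_section (funext fun k' => by
      change F.presheaf.germ _ _ _ (fstSec h hσ₀ (res W k w)) =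
        F.presheaf.germ _ _ _ (fstSec h hσ₀ w)
      rw [← res_fstSec, germ_res]) (app_res (dualProj ω j) k w)

variable (hp : IsPrincipalPartOf σ₀ p ω j) (hU₀ : genericPoint C ∈ U₀)

/-- A section of F projects to zero in F^* ⊗ L, so nothing is subtracted from it in the first
component. -/
lemma comp_toExt : j ≫ toExt h hσ₀ hp hU₀ = extIncl (symPrin p) := by
  refine Scheme.Modules.hom_ext _ _ fun U => ?_
  ext f
  refine ext_section (funext fun k => ?_) (h.isotropic U f)
  change F.presheaf.germ _ _ _ (fstSec h hσ₀ (j.app U f)) = F.presheaf.germ _ _ k.down f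
  have e : fstSec h hσ₀ (j.app U f) = res F inf_le_left f := h.injective _ (by
    rw [app_fstSec, h.isotropic, map_zero, map_zero, sub_zero, app_res])
  rw [e, germ_res]

lemma toExt_extProj : toExt h hσ₀ hp hU₀ ≫ extProj (symPrin p) = dualProj ω j := rfl

/-- The map is the middle term of a morphism of short exact sequences whose outer terms are
identities, so the five lemma applies. -/
lemma isIso_toExt (hF : TorsionFree F)
    (loc : ∀ x : C, ∃ (U : C.Opens) (σ : Γ(homSheaf (twistedDual F L) W, U)), x ∈ U ∧
      IsLagrangianSection ω j σ) : IsIso (toExt h hσ₀ hp hU₀) := by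
  have w : j ≫ dualProj ω j = 0 := Scheme.Modules.hom_ext _ _ fun U => by
    ext f
    exact h.isotropic U f
  let Φ : ShortComplex.mk j (dualProj ω j) w ⟶ extSeq (symPrin p) :=
    { τ₁ := 𝟙 F
      τ₂ := toExt h hσ₀ hp hU₀
      τ₃ := 𝟙 (twistedDual F L)
      comm₁₂ := (Category.id_comp _).trans (comp_toExt h hσ₀ hp hU₀).symm
      comm₂₃ := (toExt_extProj h hσ₀ hp hU₀).trans (Category.comp_id _).symm }
  have : IsIso Φ.τ₁ := inferInstanceAs (IsIso (𝟙 F))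
  have : IsIso Φ.τ₃ := inferInstanceAs (IsIso (𝟙 (twistedDual F L)))
  exact ShortComplex.isIso₂_of_shortExact_of_isIso₁₃ Φ (h.shortExact loc w)
    (extSeq_shortExact _ hF)

/-- Under `W ⟶ W_p` the form `ω` corresponds to the standard form. -/
lemma toRat_pairing (U : C.Opens) (v w : Γ(W, U)) :
    (show RatSec L U from (toRat L).app U (pairing ω v w)) =
      stdForm ((toExt h hσ₀ hp hU₀).app U v) ((toExt h hσ₀ hp hU₀).app U w) := by
  funext k
  have hT : genericPoint C ∈ U ⊓ U₀ := ⟨k.down, hU₀⟩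
  let φ : Γ(W, U) → Γ(twistedDual F L, U ⊓ U₀) := fun v =>
    res _ inf_le_left ((dualProj ω j).app U v)
  have dec : ∀ v : Γ(W, U), res W (inf_le_left : U ⊓ U₀ ≤ U) v =
      j.app _ (fstSec h hσ₀ v) + ev σ₀ inf_le_right (φ v) := fun v => by
    rw [app_fstSec, sub_add_cancel]
  -- Each vector is split over U ∩ U₀ as an element of F plus a value of σ₀. Both summands are
  -- isotropic, so only the two mixed terms remain.
  have e : res L (inf_le_left : U ⊓ U₀ ≤ U) (pairing ω v w) =
      ev (φ v) le_rfl (fstSec h hσ₀ w) - ev (φ w) le_rfl (fstSec h hσ₀ v) := by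
    rw [← pairing_res, dec v, dec w, pairing_add_left, pairing_add_right, pairing_add_right,
      hσ₀.isotropic, h.skew _ (j.app _ (fstSec h hσ₀ v)) (ev σ₀ _ _),
      pairing_section (h.isotropic _ _), pairing_section (hσ₀.proj _ _ _),
      pairing_section (hσ₀.proj _ _ _), ev_zero]
    abel
  change L.presheaf.germ U _ k.down (pairing ω v w) =
    stalkEv _ ((twistedDual F L).presheaf.germ U _ k.down ((dualProj ω j).app U v))
      (F.presheaf.germ (U ⊓ U₀) _ hT (fstSec h hσ₀ w)) -
    stalkEv _ ((twistedDual F L).presheaf.germ U _ k.down ((dualProj ω j).app U w))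
      (F.presheaf.germ (U ⊓ U₀) _ hT (fstSec h hσ₀ v))
  rw [← germ_res L (inf_le_left : U ⊓ U₀ ≤ U) _ hT, e, map_sub,
    ← germ_res _ (inf_le_left : U ⊓ U₀ ≤ U) _ hT, ← germ_res _ (inf_le_left : U ⊓ U₀ ≤ U) _ hT,
    stalkEv_germ, stalkEv_germ]

end PrincipalPart

end SympExt

/-! ### Proof of the theorem -/

open SympExt in
theorem lemma3p1 (C : Scheme.{0}) [IsIntegral C] (f : C ⟶ Spec (CommRingCat.of ℂ))
    [IsProper f] [SmoothOfRelativeDimension 1 f] (n : ℕ) (L W F : C.Modules)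
    (hL : SympExt.IsVectorBundle L 1) (hW : SympExt.IsVectorBundle W (2 * n))
    (ω : W ⟶ SympExt.homSheaf W L) (hω : SympExt.IsSymplectic ω)
    (j : F ⟶ W) (hj : SympExt.IsLagrangian n ω j) :
    (∃ (p : SympExt.Prin (SympExt.symSheaf F L))
        (ωp : SympExt.sympSheaf p ⟶ SympExt.homSheaf (SympExt.sympSheaf p) L)
        (ι : W ≅ SympExt.sympSheaf p),
        SympExt.IsSymplectic ωp ∧ SympExt.IsStandardForm ωp ∧
        (∀ (U : C.Opens) (v w : Γ(W, U)),
          SympExt.pairing ωp (ι.hom.app U v) (ι.hom.app U w) = SympExt.pairing ω v w) ∧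
        j ≫ ι.hom = SympExt.extIncl (SympExt.symPrin p)) ∧
    (∀ p : SympExt.Prin (SympExt.symSheaf F L),
        (SympExt.extSeq (SympExt.symPrin p)).ShortExact ∧
        ∃ (hE : (SympExt.homSeq (SympExt.extSeq (SympExt.symPrin p))).ShortExact)
          (hS : (SympExt.prinSeq (SympExt.symSheaf F L)).ShortExact),
          ∀ c : SympExt.H1 (SympExt.symSheaf F L),
            SympExt.H1map (SympExt.symIncl F L) c = SympExt.extensionClass hE ↔
              c = SympExt.prinClass hS p) := by
  obtain ⟨c, hc⟩ := exists_half f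
  have hFb := hj.subbundle.isVectorBundle
  have hF : TorsionFree F := TorsionFree.of_isVectorBundle hFb
  have hS : TorsionFree (symSheaf F L) := hF.symSheaf
  have hr : Reflexive F L := Reflexive.of_isVectorBundle hFb hL
  refine ⟨?_, fun p => ⟨extSeq_shortExact _ hF, homSeq_extSeq_shortExact _ hF,
    hS.prinSeq_shortExact, fun c' => ?_⟩⟩
  · have h := hj.isLagrangianSequence hL hW hω
    have := hω.nondegenerate
    have loc : ∀ x : C, ∃ (U : C.Opens) (σ : Γ(homSheaf (twistedDual F L) W, U)), x ∈ U ∧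
        IsLagrangianSection ω j σ := fun x => by
      obtain ⟨U, ρ, hx, hρ⟩ := hj.subbundle.exists_retraction x
      obtain ⟨σ, hσ⟩ := exists_isLagrangianSection hc hr h (sectionOfRetraction (ω := ω) ρ)
        fun V hV a => dualProj_sectionOfRetraction hρ hV a
      exact ⟨U, σ, hx, hσ⟩
    -- An isotropic splitting near the generic point is a rational splitting of W; it serves as the
    -- reference for p.
    obtain ⟨U₀, σ₀, hU₀, hσ₀⟩ := loc (genericPoint C)
    obtain ⟨p, hp⟩ := exists_principalPart h hσ₀ hU₀ loc
    have := isIso_toExt h hσ₀ hp hU₀ hF loc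
    -- The regular form on W_p is the transport of ω, so it is symplectic from the start; it is
    -- identified with the standard form afterwards.
    let ι : W ≅ sympSheaf p := asIso (toExt h hσ₀ hp hU₀)
    refine ⟨p, transportForm ι ω, ι, hω.transportForm ι, fun U v w => ?_, fun U v w => ?_,
      comp_toExt h hσ₀ hp hU₀⟩
    · rw [pairing_transportForm, toRat_pairing h hσ₀ hp hU₀]
      congr 1
      · exact inv_hom_app ι v
      · exact inv_hom_app ι w
    · rw [pairing_transportForm, hom_inv_app, hom_inv_app]
  · rw [← H1map_prinClass p hS (symIncl F L) (homSeq_extSeq_shortExact _ hF)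
      hS.prinSeq_shortExact]
    exact (H1map_injective_of_retraction _ _ (symIncl_symmetrize hr hc)).eq_iff
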